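/- All groups are written additively. For a map $f$ from a group $G$ to an abelian group put $(x|y)_f=f(x+y)-f(x)-f(y)$; $f$ is called quadratic if $(x|y)_f$ is linear in $x$ and in $y$. A *square group* $M$ consists of a group $M_{e}$, an abelian group $M_{ee}$, a quadratic map $H:M_e\to M_{ee}$ and a homomorphism $P:M_{ee}\to M_e$ with $(Pa|y)_H=0=(x|Pb)_H$, $P(x|y)_H=-x-y+x+y$ and $PHP(a)=2P(a)$ for all $x,y\in M_e$, $a,b\in M_{ee}$. A morphism $f:M\to N$ is a pair of homomorphisms $f_e:M_e\to N_e$, $f_{ee}:M_{ee}\to N_{ee}$ commuting with $H$ and $P$; this gives the category $\mathsf{SG}$. Put $T=HP-\mathrm{Id}$ on $M_{ee}$ and $\Delta(x)=HPH(x)+H(x+x)-4H(x)$ for $x\in M_e$. The image of $P$ is normal with abelian quotient $\mathrm{Coker}(P)$; write $\bar x$ for the class of $x\in M_e$. Let $\mathbb Z_{\mathrm{nil}}$ be the square group with both levels equal to $\mathbb Z$, $H(n)=\binom n2$ and $P=0$. For square groups $M,N$ let $(M\circledcirc N)_e$ be the group with generators $x\circledcirc y$ ($x\in M_e$, $y\in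 N_e$) and $a\bar\otimes b$ ($a\in M_{ee}$, $b\in N_{ee}$) and relations: 1. $a\bar\otimes b$ is bilinear and central; 2. $x\circledcirc(y_1+y_2)=x\circledcirc y_1+x\circledcirc y_2$; 3. $(x_1+x_2)\circledcirc y=x_1\circledcirc y+x_2\circledcirc y+(x_2|x_1)_H\bar\otimes H(y)$; 4. $x\circledcirc P(b)=(x|x)_H\bar\otimes b$; 5. $P(a)\circledcirc y=a\bar\otimes\Delta(y)$; 6. $T(a)\bar\otimes T(b)=-a\bar\otimes b$. Let $(M\circledcirc N)_{ee}=M_{ee}\otimes N_{ee}$. **Theorem.** (a) For all square groups $M,N$ these two groups form a square group $M\circledcirc N$ in which $P(a\otimes b)=a\bar\otimes b$ and $H$ is the unique quadratic map with $H(x\circledcirc y)=(x|x)_H\otimes H(y)+H(x)\otimes\Delta(y)$, $H(a\bar\otimes b)=a\otimes b-T(a)\otimes T(b)$ and cross-effect determined by $(x\circledcirc y\,|\,x'\circledcirc y')_H=(x|x')_H\otimes(y|y')_H$ and $(a\bar\otimes b\,|\,w)_H=0=(w\,|\,a\bar\otimes b)_H$. The rule $\overline{x\circledcirc y}\mapsto\bar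 x\otimes\bar y$ defines an isomorphism $\mathrm{Coker}(P^{M\circledcirc N})\cong\mathrm{Coker}(P^M)\otimes\mathrm{Coker}(P^N)$, and under it the cross-effect of $H$ is induced by the homomorphism $\rho$ with $\rho(\bar x\otimes\bar y\otimes\bar x'\otimes\bar y')=(x|x')_H\otimes(y|y')_H$. (b) For morphisms $f:M\to M'$ and $g:N\to N'$ the rules $x\circledcirc y\mapsto f_e(x)\circledcirc g_e(y)$, $a\bar\otimes b\mapsto f_{ee}(a)\bar\otimes g_{ee}(b)$ and $a\otimes b\mapsto f_{ee}(a)\otimes g_{ee}(b)$ define a morphism $M\circledcirc N\to M'\circledcirc N'$, and so a bifunctor $\circledcirc:\mathsf{SG}\times\mathsf{SG}\to\mathsf{SG}$. It makes $\mathsf{SG}$ a symmetric monoidal category with unit object $\mathbb Z_{\mathrm{nil}}$. The associativity and commutativity isomorphisms are on the $ee$-level the usual ones, $(a\otimes b)\otimes c\mapsto a\otimes(b\otimes c)$ and $a\otimes b\mapsto b\otimes a$. On the $e$-level the associativity isomorphism $(A\circledcirc B)\circledcirc C\cong A\circledcirc(B\circledcirc C)$ is given by $$(x\circledcirc y)\circledcirc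 z\mapsto x\circledcirc(y\circledcirc z),\quad (a\bar\otimes b)\circledcirc z\mapsto a\bar\otimes(b\otimes\Delta(z)),\quad (a\otimes b)\bar\otimes c\mapsto a\bar\otimes(b\otimes c),$$ and the commutativity isomorphism $A\circledcirc B\cong B\circledcirc A$ is given by $$x\circledcirc y\mapsto y\circledcirc x-H(y)\bar\otimes TH(x),\qquad a\bar\otimes b\mapsto b\bar\otimes a.$$ Moreover $x\circledcirc(b\bar\otimes c)=(x|x)_H\bar\otimes(b\otimes c)$ in $A\circledcirc(B\circledcirc C)$, and under the associativity isomorphism this element corresponds to $((x|x)_H\otimes b)\bar\otimes c$. (c) Sending an abelian group $A$ to the square group with $e$-level $A$ and $ee$-level $0$ is a fully faithful functor from abelian groups to $\mathsf{SG}$ whose essential image consists of the $M$ with $M_{ee}=0$. On this subcategory $\circledcirc$ coincides with the usual tensor product: $x\circledcirc y\mapsto x\otimes y$ gives isomorphisms $A\circledcirc B\cong A\otimes B$, natural in the abelian groups $A$ and $B$ and compatible with the associativity and commutativity isomorphisms. -/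

import Mathlib

open CategoryTheory
open scoped TensorProduct

universe u v

/-! ## Square groups -/

/-- The cross-effect `(x | y)_f = f (x + y) - f x - f y` of a map from an additively written
(not necessarily commutative) group to an abelian group. -/
def crossEffect {G A : Type*} [AddGroup G] [AddCommGroup A] (f : G → A) (x y : G) : A :=
  f (x + y) - f x - f y

/-- A map is quadratic if its cross-effect is linear in both variables. -/
structure IsQuadratic {G A : Type*} [AddGroup G] [AddCommGroup A] (f : G → A) : Prop where
  cross_add_left : ∀ x x' y : G,
    crossEffect f (x + x') y = crossEffect f x y + crossEffect f x' y
  cross_add_right : ∀ x y y' : G,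
    crossEffect f x (y + y') = crossEffect f x y + crossEffect f x y'

/-- The structure of a square group with given e-level `G` and ee-level `A`. -/
structure SquareStr (G A : Type u) [AddGroup G] [AddCommGroup A] where
  /-- the quadratic map `H` -/
  H : G → A
  /-- the homomorphism `P` -/
  P : A →+ G
  quadratic : IsQuadratic H
  cross_P_left : ∀ (a : A) (y : G), crossEffect H (P a) y = 0
  cross_P_right : ∀ (x : G) (b : A), crossEffect H x (P b) = 0
  P_cross : ∀ x y : G, P (crossEffect H x y) = -x - y + x + y
  PHP : ∀ a : A, P (H (P a)) = P a + P a

/-- A square group `e --H--> ee --P--> e`. -/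
structure SquareGroup : Type (u + 1) where
  e : Type u
  ee : Type u
  [addGroup : AddGroup e]
  [addCommGroup : AddCommGroup ee]
  str : SquareStr e ee

attribute [instance] SquareGroup.addGroup SquareGroup.addCommGroup

namespace SquareGroup

/-- Bundling. -/
abbrev of {G A : Type u} [AddGroup G] [AddCommGroup A] (S : SquareStr G A) : SquareGroup.{u} :=
  ⟨G, A, S⟩

/-- The quadratic map `H`. -/
abbrev H (M : SquareGroup.{u}) : M.e → M.ee := M.str.H

/-- The homomorphism `P`. -/
abbrev P (M : SquareGroup.{u}) : M.ee →+ M.e := M.str.P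

/-- The cross-effect `(x | y)_H`. -/
abbrev cr (M : SquareGroup.{u}) (x y : M.e) : M.ee := crossEffect M.H x y

/-- `T = HP - Id`. -/
def T (M : SquareGroup.{u}) (a : M.ee) : M.ee := M.H (M.P a) - a

/-- `Δ(x) = HPH(x) + H(x + x) - 4 H(x)`. -/
def Δ (M : SquareGroup.{u}) (x : M.e) : M.ee :=
  M.H (M.P (M.H x)) + M.H (x + x) - 4 • M.H x

/-- A morphism of square groups: a pair of homomorphisms compatible with `H` and `P`. -/
@[ext]
structure Hom (M N : SquareGroup.{u}) where
  e : M.e →+ N.e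
  ee : M.ee →+ N.ee
  map_H : ∀ x : M.e, ee (M.H x) = N.H (e x)
  map_P : ∀ a : M.ee, e (M.P a) = N.P (ee a)

instance : Category.{u} SquareGroup.{u} where
  Hom := Hom
  id M := ⟨AddMonoidHom.id _, AddMonoidHom.id _, fun _ => rfl, fun _ => rfl⟩
  comp f g := ⟨g.e.comp f.e, g.ee.comp f.ee,
    fun x => by simp [f.map_H, g.map_H], fun a => by simp [f.map_P, g.map_P]⟩

/-- The square group `ℤ_nil`: both levels are `ℤ`, `H(n) = n(n-1)/2` and `P = 0`. -/
def Znil : SquareGroup.{u} where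
  e := ULift.{u} ℤ
  ee := ULift.{u} ℤ
  str :=
    { H := fun n => ⟨n.down * (n.down - 1) / 2⟩
      P := 0
      quadratic := by
        have key : ∀ x y : ULift.{u} ℤ, crossEffect
            (fun n : ULift.{u} ℤ => (⟨n.down * (n.down - 1) / 2⟩ : ULift.{u} ℤ)) x y
              = ⟨x.down * y.down⟩ := by
          rintro ⟨x⟩ ⟨y⟩
          apply ULift.ext
          change (x + y) * (x + y - 1) / 2 - x * (x - 1) / 2 - y * (y - 1) / 2 = x * y
          have h : (x + y) * (x + y - 1) = x * (x - 1) + y * (y - 1) + 2 * (x * y) := by ring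
          have hx := (Int.even_mul_pred_self x).two_dvd
          have hy := (Int.even_mul_pred_self y).two_dvd
          rw [h]
          generalize x * (x - 1) = a at *
          generalize y * (y - 1) = b at *
          generalize x * y = c at *
          omega
        constructor
        · intro x x' y
          simp only [key]
          exact ULift.ext _ _ (add_mul x.down x'.down y.down)
        · intro x y y'
          simp only [key]
          exact ULift.ext _ _ (mul_add x.down y.down y'.down)
      cross_P_left := fun a y => by simp [crossEffect]; rfl
      cross_P_right := fun x b => by simp [crossEffect]; rfl
      P_cross := fun x y => by simp; abel
      PHP := fun a => by simp }

/-! ### The cokernel of `P` -/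

/-- The image of `P` is a normal (even central) subgroup of the e-level. -/
instance normal_range_P (M : SquareGroup.{u}) : M.P.range.Normal where
  conj_mem := by
    rintro _ ⟨a, rfl⟩ g
    have h := M.str.P_cross (M.P a) (-g)
    rw [M.str.cross_P_left, map_zero] at h
    refine ⟨a, ?_⟩
    have h2 : M.P a + -g = -g + M.P a := by
      have h3 := congrArg (fun z => (-g + M.P a) + z) h
      simpa [sub_eq_add_neg, add_assoc] using h3.symm
    rw [add_assoc, h2, add_neg_cancel_left]

/-- `Coker(P)`, the quotient of the e-level by the image of `P`. -/
def Coker (M : SquareGroup.{u}) : Type u := M.e ⧸ M.P.range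

/-- `Coker(P)` is abelian since the commutator of `x` and `y` is `P (x | y)_H`. -/
instance (M : SquareGroup.{u}) : AddCommGroup M.Coker :=
  { (inferInstance : AddGroup (M.e ⧸ M.P.range)) with
    add_comm := by
      intro a b
      induction a using QuotientAddGroup.induction_on with | H x => ?_
      induction b using QuotientAddGroup.induction_on with | H y => ?_
      change ((x + y : M.e) : M.e ⧸ M.P.range) = ((y + x : M.e) : M.e ⧸ M.P.range)
      rw [eq_comm, QuotientAddGroup.eq]
      refine ⟨M.cr x y, (M.str.P_cross x y).trans ?_⟩
      rw [neg_add_rev, sub_eq_add_neg, add_assoc] }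

/-- The class `x̄` in `Coker(P)` of an element of the e-level. -/
def cls (M : SquareGroup.{u}) : M.e →+ M.Coker := QuotientAddGroup.mk' M.P.range

/-! ### Abelian groups as square groups -/

/-- An abelian group as the square group with trivial ee-level. -/
abbrev ofAb (A : Type u) [AddCommGroup A] : SquareGroup.{u} where
  e := A
  ee := PUnit.{u + 1}
  str :=
    { H := fun _ => 0
      P := 0
      quadratic := ⟨fun _ _ _ => rfl, fun _ _ _ => rfl⟩
      cross_P_left := fun _ _ => rfl
      cross_P_right := fun _ _ => rfl
      P_cross := fun x y => by simp; abel
      PHP := fun a => by simp }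

/-- The functor from abelian groups to square groups, `A ↦ (A → 0 → A)`. -/
def abFunctor : AddCommGrpCat.{u} ⥤ SquareGroup.{u} where
  obj A := ofAb A
  map f := ⟨f.hom, 0, fun _ => rfl, fun _ => map_zero f.hom⟩
  map_id _ := Hom.ext rfl rfl
  map_comp _ _ := Hom.ext rfl rfl

/-! ### The tensor product -/

/-- Symbols `x ⊛ y` (`op x y`) and `a ⊗̄ b` (`bar a b`) generating the e-level of `M ⊛ N`. -/
inductive TensorGen (M N : SquareGroup.{u}) : Type u
  | op (x : M.e) (y : N.e)
  | bar (a : M.ee) (b : N.ee)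

/-- The word consisting of the single letter `x ⊛ y`. -/
abbrev wop {M N : SquareGroup.{u}} (x : M.e) (y : N.e) : FreeAddGroup (TensorGen M N) :=
  FreeAddGroup.of (TensorGen.op x y)

/-- The word consisting of the single letter `a ⊗̄ b`. -/
abbrev wbar {M N : SquareGroup.{u}} (a : M.ee) (b : N.ee) : FreeAddGroup (TensorGen M N) :=
  FreeAddGroup.of (TensorGen.bar a b)

/-- The defining relations of the e-level of `M ⊛ N`. -/
inductive TensorRel (M N : SquareGroup.{u}) :
    FreeAddGroup (TensorGen M N) → FreeAddGroup (TensorGen M N) → Prop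
  | bar_add_left (a a' : M.ee) (b : N.ee) :
      TensorRel M N (wbar (a + a') b) (wbar a b + wbar a' b)
  | bar_add_right (a : M.ee) (b b' : N.ee) :
      TensorRel M N (wbar a (b + b')) (wbar a b + wbar a b')
  | bar_central (a : M.ee) (b : N.ee) (w : FreeAddGroup (TensorGen M N)) :
      TensorRel M N (wbar a b + w) (w + wbar a b)
  | op_add_right (x : M.e) (y₁ y₂ : N.e) :
      TensorRel M N (wop x (y₁ + y₂)) (wop x y₁ + wop x y₂)
  | op_add_left (x₁ x₂ : M.e) (y : N.e) :
      TensorRel M N (wop (x₁ + x₂) y) (wop x₁ y + wop x₂ y + wbar (M.cr x₂ x₁) (N.H y))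
  | op_P (x : M.e) (b : N.ee) :
      TensorRel M N (wop x (N.P b)) (wbar (M.cr x x) b)
  | P_op (a : M.ee) (y : N.e) :
      TensorRel M N (wop (M.P a) y) (wbar a (N.Δ y))
  | bar_T (a : M.ee) (b : N.ee) :
      TensorRel M N (wbar (M.T a) (N.T b)) (-wbar a b)

/-- The e-level of `M ⊛ N`: the group with the above generators and relations, i.e. the quotient
of the free group on the generators by the least congruence containing the relations. -/
abbrev TensorE (M N : SquareGroup.{u}) : Type u := (addConGen (TensorRel M N)).Quotient

/-- The element `x ⊛ y` of the e-level of `M ⊛ N`. -/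
def op (M N : SquareGroup.{u}) (x : M.e) (y : N.e) : TensorE M N :=
  ((wop x y : FreeAddGroup (TensorGen M N)) : (addConGen (TensorRel M N)).Quotient)

/-- The element `a ⊗̄ b` of the e-level of `M ⊛ N`. -/
def bar (M N : SquareGroup.{u}) (a : M.ee) (b : N.ee) : TensorE M N :=
  ((wbar a b : FreeAddGroup (TensorGen M N)) : (addConGen (TensorRel M N)).Quotient)

/-- The conditions describing the map `H` of `M ⊛ N`: it is quadratic, its cross-effect is
`(x ⊛ y | x' ⊛ y')_H = (x | x')_H ⊗ (y | y')_H` and vanishes as soon as one of the arguments is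
some `a ⊗̄ b`, and it has the prescribed values on the generators. -/
structure IsTensorH (M N : SquareGroup.{u}) (h : TensorE M N → M.ee ⊗[ℤ] N.ee) : Prop where
  quadratic : IsQuadratic h
  cross_op : ∀ (x x' : M.e) (y y' : N.e),
    crossEffect h (op M N x y) (op M N x' y') = M.cr x x' ⊗ₜ[ℤ] N.cr y y'
  cross_bar_left : ∀ (a : M.ee) (b : N.ee) (w : TensorE M N), crossEffect h (bar M N a b) w = 0
  cross_bar_right : ∀ (a : M.ee) (b : N.ee) (w : TensorE M N), crossEffect h w (bar M N a b) = 0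
  map_op : ∀ (x : M.e) (y : N.e),
    h (op M N x y) = M.cr x x ⊗ₜ[ℤ] N.H y + M.H x ⊗ₜ[ℤ] N.Δ y
  map_bar : ∀ (a : M.ee) (b : N.ee),
    h (bar M N a b) = a ⊗ₜ[ℤ] b - M.T a ⊗ₜ[ℤ] N.T b

end SquareGroup

/-! ## Symmetric monoidal structures with prescribed data -/

/-- The data (without the axioms) of a symmetric monoidal structure on a category. -/
structure SymmetricMonoidalData (C : Type u) [Category.{v} C] extends
    MonoidalCategoryStruct C where
  braiding : ∀ X Y : C, tensorObj X Y ≅ tensorObj Y X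

/-- The data underlying a symmetric monoidal category. -/
def SymmetricMonoidalData.ofSymmetric (C : Type u) [Category.{v} C] [M : MonoidalCategory C]
    [SymmetricCategory C] : SymmetricMonoidalData C :=
  { M.toMonoidalCategoryStruct with braiding := fun X Y => BraidedCategory.braiding X Y }

/-- The data satisfy all the axioms of a symmetric monoidal category. -/
def SymmetricMonoidalData.IsSymmetricMonoidal {C : Type u} [Category.{v} C]
    (D : SymmetricMonoidalData C) : Prop :=
  ∃ (_ : MonoidalCategory C) (_ : SymmetricCategory C),
    SymmetricMonoidalData.ofSymmetric C = D

/-! ## Elementary calculus in a square group -/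

namespace SquareGroup

section Basic

variable (M : SquareGroup.{u})

/-! The calculus rests on two operators. `T` is an involution with `PT = P` and `T(x|y) = -(y|x)`;
`Δ` is additive with `ΔP = 0` and `TΔ = -Δ`. Values of `P` are central and every commutator is one.
Hence an equation in the e-level whose two sides differ only by values of `P` becomes a linear
computation in the ee-level modulo elements `T c - c`, which `P` kills (`P_eq_of_eq_add`).

A presented group comes with homomorphisms out of it, whereas `H` is only quadratic. A map that is
additive up to a bilinear cocycle on the cokernels is therefore read off as the first coordinate of
a homomorphism into the central extension `Twist` (`TensorE.exists_twistedLift`). With the cocycle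
`rho` this gives `H`. With a cocycle depending on a fixed `z` it gives the image of `w ⊛ z` under
associativity, where `w ↦ w ⊛ z` has defect `(w'|w) ⊗ H z`. The commutator law comes from expanding
`(x' + x) ⊛ (y + y')` in two ways.

A morphism out of a tensor product is constructed by checks on generators (`exists_hom`) and is
determined by its ee-part and its values on iterated symbols `x ⊛ y`. The associator has no
correction term on those symbols, so the pentagon is immediate, and the triangle and hexagons only
compare corrections lying in the image of `P`. The left unit and the inverse associator are obtained
by conjugating with the commutativity morphism. For abelian groups the ee-level vanishes and with it
every correction. -/

lemma cr_add_left (x x' y : M.e) : M.cr (x + x') y = M.cr x y + M.cr x' y :=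
  M.str.quadratic.cross_add_left x x' y

lemma cr_add_right (x y y' : M.e) : M.cr x (y + y') = M.cr x y + M.cr x y' :=
  M.str.quadratic.cross_add_right x y y'

/-- The cross-effect of `H` as a bilinear map. -/
def crHom : M.e →+ M.e →+ M.ee :=
  AddMonoidHom.mk' (fun x => AddMonoidHom.mk' (M.cr x) (M.cr_add_right x))
    fun x x' => AddMonoidHom.ext fun y => M.cr_add_left x x' y

@[simp] lemma cr_P_left (a : M.ee) (y : M.e) : M.cr (M.P a) y = 0 := M.str.cross_P_left a y

@[simp] lemma cr_P_right (x : M.e) (b : M.ee) : M.cr x (M.P b) = 0 := M.str.cross_P_right x b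

@[simp] lemma cr_zero_right (x : M.e) : M.cr x 0 = 0 := map_zero (M.crHom x)

lemma cr_zsmul_left (n : ℤ) (x y : M.e) : M.cr (n • x) y = n • M.cr x y :=
  DFunLike.congr_fun (map_zsmul M.crHom n x) y

lemma cr_zsmul_right (n : ℤ) (x y : M.e) : M.cr x (n • y) = n • M.cr x y :=
  map_zsmul (M.crHom x) n y

lemma H_add (x y : M.e) : M.H (x + y) = M.H x + M.H y + M.cr x y := by
  simp only [cr, crossEffect]; abel

@[simp] lemma H_zero : M.H 0 = 0 := by
  have h := M.H_add 0 0
  simpa using h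

lemma H_add_P (x : M.e) (a : M.ee) : M.H (x + M.P a) = M.H x + M.H (M.P a) := by
  simp [H_add]

lemma P_comm (a : M.ee) (x : M.e) : M.P a + x = x + M.P a := by
  have h := M.str.P_cross (M.P a) x
  rw [M.str.cross_P_left, map_zero] at h
  have h2 := congrArg (fun z => x + M.P a + z) h
  simpa [sub_eq_add_neg, add_assoc] using h2.symm

/-- Elements commute up to the cross-effect. -/
lemma add_comm_P (x y : M.e) : x + y = y + x + M.P (M.cr x y) := by
  rw [M.str.P_cross, sub_eq_add_neg]; simp [add_assoc]

/-- `HP` as a homomorphism. -/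
def HP : M.ee →+ M.ee :=
  AddMonoidHom.mk' (fun a => M.H (M.P a)) fun a b => by simp [H_add]

/-- `T` as a homomorphism. -/
def THom : M.ee →+ M.ee := M.HP - AddMonoidHom.id _

lemma THom_apply (a : M.ee) : M.THom a = M.T a := rfl

@[simp] lemma T_add (a b : M.ee) : M.T (a + b) = M.T a + M.T b := map_add M.THom a b
@[simp] lemma T_neg (a : M.ee) : M.T (-a) = -M.T a := map_neg M.THom a
@[simp] lemma T_sub (a b : M.ee) : M.T (a - b) = M.T a - M.T b := map_sub M.THom a b

lemma H_P (a : M.ee) : M.H (M.P a) = a + M.T a := by simp [T]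

@[simp] lemma P_T (a : M.ee) : M.P (M.T a) = M.P a := by
  simp only [T, map_sub]; rw [show M.P (M.H (M.P a)) = _ from M.str.PHP a]; simp

-- Since `PT = P`, `HP` takes the same value on `a` and `T a`; now use `HP = Id + T`.
@[simp] lemma T_T (a : M.ee) : M.T (M.T a) = a := by
  have h : M.H (M.P (M.T a)) = M.H (M.P a) := by rw [P_T]
  rw [H_P, H_P, add_comm] at h
  exact add_right_cancel h

/-- Apply `H` to `x + y = y + x + P(x|y)` and cancel. -/
lemma T_cr (x y : M.e) : M.T (M.cr x y) = -M.cr y x := by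
  have h := congrArg M.H (M.add_comm_P x y)
  rw [H_add_P, H_P, H_add, H_add, add_comm (M.H y)] at h
  have h2 : M.cr x y + (M.cr y x + M.T (M.cr x y)) = M.cr x y + 0 := by
    rw [add_zero, add_left_comm]
    exact (add_left_cancel (h.trans (add_assoc _ _ _))).symm
  exact eq_neg_of_add_eq_zero_right (add_left_cancel h2)

@[simp] lemma P_cr_self (x : M.e) : M.P (M.cr x x) = 0 := by
  rw [M.str.P_cross]; simp [sub_eq_add_neg, add_assoc]

lemma Δ_eq (x : M.e) : M.Δ x = M.cr x x + M.T (M.H x) - M.H x := by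
  simp only [Δ, H_P, H_add]; abel

/-- The three summands in `Δ_eq` have cross-effects `(x|y) + (y|x)`, `T(x|y) = -(y|x)` and `-(x|y)`,
which cancel. -/
lemma Δ_add (x y : M.e) : M.Δ (x + y) = M.Δ x + M.Δ y := by
  simp only [Δ_eq, H_add, cr_add_left, cr_add_right, T_add, T_cr]; abel

@[simp] lemma Δ_P (a : M.ee) : M.Δ (M.P a) = 0 := by
  simp [Δ_eq, H_P, add_comm]

@[simp] lemma T_Δ (x : M.e) : M.T (M.Δ x) = -M.Δ x := by
  simp only [Δ_eq, T_sub, T_add, T_cr, T_T]; abel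

end Basic

/-! ### Morphisms and their compatibility with the operators. -/

variable {M N X : SquareGroup.{u}}

@[ext] lemma hom_ext {f g : M ⟶ N} (he : f.e = g.e) (hee : f.ee = g.ee) : f = g := Hom.ext he hee

@[simp] lemma comp_e (f : M ⟶ N) (g : N ⟶ X) (x : M.e) : (f ≫ g).e x = g.e (f.e x) := rfl
@[simp] lemma comp_ee (f : M ⟶ N) (g : N ⟶ X) (x : M.ee) : (f ≫ g).ee x = g.ee (f.ee x) := rfl
@[simp] lemma id_e (x : M.e) : Hom.e (𝟙 M) x = x := rfl
@[simp] lemma id_ee (x : M.ee) : Hom.ee (𝟙 M) x = x := rfl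

namespace Hom

lemma map_cr (f : M ⟶ N) (x y : M.e) : f.ee (M.cr x y) = N.cr (f.e x) (f.e y) := by
  simp only [cr, crossEffect, map_sub, f.map_H, map_add]

lemma map_T (f : M ⟶ N) (a : M.ee) : f.ee (M.T a) = N.T (f.ee a) := by
  simp only [T, map_sub, f.map_H, f.map_P]

lemma map_Δ (f : M ⟶ N) (x : M.e) : f.ee (M.Δ x) = N.Δ (f.e x) := by
  simp only [Δ_eq, map_sub, map_add, f.map_H, map_T, map_cr]

end Hom

/-! ### The cross-effect on the cokernel -/

@[simp] lemma cls_P (a : M.ee) : M.cls (M.P a) = 0 :=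
  (QuotientAddGroup.eq_zero_iff _).2 ⟨a, rfl⟩

lemma cls_surjective : Function.Surjective M.cls := QuotientAddGroup.mk'_surjective _

/-- Homomorphisms out of `Coker(P)`. -/
def Coker.lift {G : Type*} [AddGroup G] (f : M.e →+ G) (hf : ∀ a, f (M.P a) = 0) : M.Coker →+ G :=
  QuotientAddGroup.lift _ f (by rintro _ ⟨a, rfl⟩; exact hf a)

variable (M) in
/-- The cross-effect of `H`, defined on `Coker(P)`. -/
def crCoker : M.Coker →+ M.Coker →+ M.ee :=
  Coker.lift
    (AddMonoidHom.mk' (fun x => Coker.lift (M.crHom x) fun a => M.cr_P_right x a) fun x x' => by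
      ext y
      obtain ⟨y, rfl⟩ := cls_surjective y
      exact M.cr_add_left x x' y)
    fun a => by
      ext y
      obtain ⟨y, rfl⟩ := cls_surjective y
      exact M.cr_P_left a y

end SquareGroup

/-! ## Central extensions by a bilinear cocycle -/

/-- The group `G × Q` with the addition twisted by a bilinear cocycle with central values. -/
structure Twist {G Q A : Type*} [AddGroup G] [AddCommGroup Q] [AddCommGroup A] (ι : A →+ G)
    (hι : ∀ a g, ι a + g = g + ι a) (β : Q →+ Q →+ A) where
  fst : G
  snd : Q

namespace Twist

variable {G Q A : Type*} [AddGroup G] [AddCommGroup Q] [AddCommGroup A] {ι : A →+ G}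
  {hι : ∀ a g, ι a + g = g + ι a} {β : Q →+ Q →+ A}

instance : Add (Twist ι hι β) := ⟨fun z w => ⟨z.fst + w.fst + ι (β z.snd w.snd), z.snd + w.snd⟩⟩
instance : Zero (Twist ι hι β) := ⟨⟨0, 0⟩⟩
instance : Neg (Twist ι hι β) := ⟨fun z => ⟨-z.fst + ι (β z.snd z.snd), -z.snd⟩⟩

lemma mk_add_mk (g g' : G) (q q' : Q) :
    (⟨g, q⟩ + ⟨g', q'⟩ : Twist ι hι β) = ⟨g + g' + ι (β q q'), q + q'⟩ := rfl

instance : AddGroup (Twist ι hι β) :=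
  AddGroup.ofLeftAxioms
    (by
      rintro ⟨g, q⟩ ⟨g', q'⟩ ⟨g'', q''⟩
      simp only [mk_add_mk, mk.injEq, map_add, AddMonoidHom.add_apply, add_assoc, and_true]
      -- Once the central value `ι (β q q')` has been moved past `g''`, both bracketings collect the
      -- same three cocycle values.
      rw [← add_assoc (ι (β q q')) g'', hι, add_assoc, ← map_add, ← map_add, ← map_add, ← map_add]
      congr 4
      abel)
    (by
      rintro ⟨g, q⟩
      change (⟨0, 0⟩ + ⟨g, q⟩ : Twist ι hι β) = _
      simp [mk_add_mk])
    (by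
      rintro ⟨g, q⟩
      change (⟨-g + ι (β q q), -q⟩ + ⟨g, q⟩ : Twist ι hι β) = ⟨0, 0⟩
      rw [mk_add_mk, add_assoc (-g), hι]
      simp)

lemma mk_neg (g : G) (q : Q) : (-⟨g, q⟩ : Twist ι hι β) = ⟨-g + ι (β q q), -q⟩ := rfl

end Twist

namespace SquareGroup

variable {M N : SquareGroup.{u}}

/-! ### The group `TensorE` -/

namespace TensorE

lemma mk_eq {w w' : FreeAddGroup (TensorGen M N)} (h : TensorRel M N w w') :
    ((w : (addConGen (TensorRel M N)).Quotient)) = w' :=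
  (AddCon.eq _).2 (AddConGen.Rel.of _ _ h)

lemma bar_add_left (a a' : M.ee) (b : N.ee) : bar M N (a + a') b = bar M N a b + bar M N a' b :=
  mk_eq (.bar_add_left a a' b)

lemma bar_add_right (a : M.ee) (b b' : N.ee) : bar M N a (b + b') = bar M N a b + bar M N a b' :=
  mk_eq (.bar_add_right a b b')

lemma bar_central (a : M.ee) (b : N.ee) (w : TensorE M N) : bar M N a b + w = w + bar M N a b := by
  induction w using AddCon.induction_on with | _ w => exact mk_eq (.bar_central a b w)

lemma op_add_right (x : M.e) (y y' : N.e) : op M N x (y + y') = op M N x y + op M N x y' :=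
  mk_eq (.op_add_right x y y')

lemma op_add_left (x x' : M.e) (y : N.e) :
    op M N (x + x') y = op M N x y + op M N x' y + bar M N (M.cr x' x) (N.H y) :=
  mk_eq (.op_add_left x x' y)

lemma op_P (x : M.e) (b : N.ee) : op M N x (N.P b) = bar M N (M.cr x x) b := mk_eq (.op_P x b)

lemma P_op (a : M.ee) (y : N.e) : op M N (M.P a) y = bar M N a (N.Δ y) := mk_eq (.P_op a y)

lemma bar_T (a : M.ee) (b : N.ee) : bar M N (M.T a) (N.T b) = -bar M N a b := mk_eq (.bar_T a b)

/-- Homomorphisms out of the group `TensorE`. -/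
def lift {G : Type*} [AddGroup G] (f : M.e → N.e → G) (g : M.ee → N.ee → G)
    (h₁ : ∀ a a' b, g (a + a') b = g a b + g a' b) (h₂ : ∀ a b b', g a (b + b') = g a b + g a b')
    (h₃ : ∀ a b z, g a b + z = z + g a b) (h₄ : ∀ x y y', f x (y + y') = f x y + f x y')
    (h₅ : ∀ x x' y, f (x + x') y = f x y + f x' y + g (M.cr x' x) (N.H y))
    (h₆ : ∀ x b, f x (N.P b) = g (M.cr x x) b) (h₇ : ∀ a y, f (M.P a) y = g a (N.Δ y))
    (h₈ : ∀ a b, g (M.T a) (N.T b) = -g a b) : TensorE M N →+ G :=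
  AddCon.lift _ (FreeAddGroup.lift fun t => match t with
    | .op x y => f x y
    | .bar a b => g a b) <| AddCon.addConGen_le.2 <| by
      intro w w' h
      rw [AddCon.ker_rel]
      cases h with
      | bar_central a b w => simpa using h₃ a b _
      | bar_add_left a a' b => simpa using h₁ a a' b
      | bar_add_right a b b' => simpa using h₂ a b b'
      | op_add_right x y y' => simpa using h₄ x y y'
      | op_add_left x x' y => simpa using h₅ x x' y
      | op_P x b => simpa using h₆ x b
      | P_op a y => simpa using h₇ a y
      | bar_T a b => simpa using h₈ a b

/-- The homomorphism `a ⊗ b ↦ a ⊗̄ b`, which will be the map `P` of the tensor product. -/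
def barHom : M.ee ⊗[ℤ] N.ee →+ TensorE M N :=
  -- Lifting to the tensor product needs a commutative target. The whole group need not be
  -- commutative, but its centre is, and it contains every `a ⊗̄ b`.
  letI : AddCommGroup (AddSubgroup.center (TensorE M N)) :=
    { (inferInstance : AddGroup (AddSubgroup.center (TensorE M N))) with
      add_comm := fun a b => Subtype.ext (AddSubgroup.mem_center_iff.1 b.2 a.1) }
  let F : M.ee →+ N.ee →+ AddSubgroup.center (TensorE M N) := AddMonoidHom.mk'
    (fun a => AddMonoidHom.mk' (fun b => ⟨bar M N a b, AddSubgroup.mem_center_iff.2 fun g =>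
        (bar_central a b g).symm⟩) fun b b' => Subtype.ext (bar_add_right a b b'))
    fun a a' => by ext b; exact bar_add_left a a' b
  (AddSubgroup.center (TensorE M N)).subtype.comp
    (TensorProduct.liftAddHom F fun r a b => by
      rw [map_zsmul, map_zsmul]; rfl)

lemma barHom_tmul (a : M.ee) (b : N.ee) : barHom (a ⊗ₜ[ℤ] b) = bar M N a b := rfl

lemma barHom_central (t : M.ee ⊗[ℤ] N.ee) (w : TensorE M N) : barHom t + w = w + barHom t := by
  induction t with
  | zero => simp
  | tmul a b => exact bar_central a b w
  | add s t hs ht => rw [map_add, add_assoc, ht, ← add_assoc, hs, add_assoc]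

lemma op_zero_right (x : M.e) : op M N x 0 = 0 := by
  simpa using op_add_right (N := N) x 0 0

lemma op_neg_right (x : M.e) (y : N.e) : op M N x (-y) = -op M N x y := by
  rw [eq_neg_iff_add_eq_zero, ← op_add_right, neg_add_cancel, op_zero_right]

lemma induction {p : TensorE M N → Prop} (hop : ∀ x y, p (op M N x y))
    (hbar : ∀ t, p (barHom t)) (hadd : ∀ w w', p w → p w' → p (w + w')) (w : TensorE M N) :
    p w := by
  induction w using AddCon.induction_on with | _ w => ?_
  induction w using FreeAddGroup.induction_on with
  | C1 => simpa using hbar 0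
  | of t => cases t with
    | op x y => exact hop x y
    | bar a b => exact hbar (a ⊗ₜ b)
  -- Inverses of generators are again of the two given forms: `-(x ⊛ y) = x ⊛ (-y)`, and the values
  -- of `barHom` form a subgroup.
  | neg_of t _ => cases t with
    | op x y => have h := hop x (-y); rw [op_neg_right] at h; exact h
    | bar a b => have h := hbar (-(a ⊗ₜ b)); rw [map_neg] at h; exact h
  | add w w' h h' => exact hadd _ _ h h'

/-- The projection to the tensor product of the cokernels. -/
def toCoker : TensorE M N →+ M.Coker ⊗[ℤ] N.Coker :=
  lift (fun x y => M.cls x ⊗ₜ N.cls y) (fun _ _ => 0) (by simp) (by simp) (by simp)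
    (by simp [TensorProduct.tmul_add]) (by simp [TensorProduct.add_tmul]) (by simp) (by simp)
    (by simp)

@[simp] lemma toCoker_op (x : M.e) (y : N.e) : toCoker (op M N x y) = M.cls x ⊗ₜ N.cls y := by
  simp [toCoker, op, lift]

@[simp] lemma toCoker_barHom (t : M.ee ⊗[ℤ] N.ee) : toCoker (barHom t) = 0 := by
  induction t with
  | zero => simp
  | tmul a b => simp [toCoker, bar, lift, barHom_tmul]
  | add s t hs ht => simp [hs, ht]

/-- Existence of maps out of `TensorE` that are additive up to a bilinear cocycle. -/
lemma exists_twistedLift {G A : Type*} [AddGroup G] [AddCommGroup A] (ι : A →+ G)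
    (hι : ∀ a g, ι a + g = g + ι a)
    (β : M.Coker ⊗[ℤ] N.Coker →+ M.Coker ⊗[ℤ] N.Coker →+ A)
    (f : M.e → N.e → G) (ψ : M.ee ⊗[ℤ] N.ee →+ A)
    (h₄ : ∀ x y y', f x (y + y') =
      f x y + f x y' + ι (β (M.cls x ⊗ₜ N.cls y) (M.cls x ⊗ₜ N.cls y')))
    (h₅ : ∀ x x' y, f (x + x') y = f x y + f x' y
      + ι (β (M.cls x ⊗ₜ N.cls y) (M.cls x' ⊗ₜ N.cls y)) + ι (ψ (M.cr x' x ⊗ₜ N.H y)))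
    (h₆ : ∀ x b, f x (N.P b) = ι (ψ (M.cr x x ⊗ₜ b)))
    (h₇ : ∀ a y, f (M.P a) y = ι (ψ (a ⊗ₜ N.Δ y)))
    (h₈ : ∀ a b, ι (ψ (M.T a ⊗ₜ N.T b)) = -ι (ψ (a ⊗ₜ b))) :
    ∃ F : TensorE M N → G,
      (∀ w w', F (w + w') = F w + F w' + ι (β (toCoker w) (toCoker w'))) ∧
      (∀ x y, F (op M N x y) = f x y) ∧ ∀ t, F (barHom t) = ι (ψ t) := by
  -- The second coordinate of `L` is `toCoker`, so the cocycle in the addition of `Twist` is exactly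
  -- the required additivity defect of the first coordinate.
  let L : TensorE M N →+ Twist ι hι β :=
    lift (fun x y => ⟨f x y, M.cls x ⊗ₜ N.cls y⟩) (fun a b => ⟨ι (ψ (a ⊗ₜ b)), 0⟩)
      (by simp [Twist.mk_add_mk, TensorProduct.add_tmul])
      (by simp [Twist.mk_add_mk, TensorProduct.tmul_add])
      (by rintro a b ⟨g, q⟩; simp [Twist.mk_add_mk, hι])
      (by simp [Twist.mk_add_mk, TensorProduct.tmul_add, h₄])
      (by simp [Twist.mk_add_mk, TensorProduct.add_tmul, h₅])
      (by simp [h₆]) (by simp [h₇]) (by simp [Twist.mk_neg, h₈])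
  have hop (x : M.e) (y : N.e) : L (op M N x y) = ⟨f x y, M.cls x ⊗ₜ N.cls y⟩ := by
    simp [L, op, lift]
  have hbar (t : M.ee ⊗[ℤ] N.ee) : L (barHom t) = ⟨ι (ψ t), 0⟩ := by
    induction t with
    | zero => simp; rfl
    | tmul a b => simp [L, bar, lift, barHom_tmul]
    | add s t hs ht => simp [hs, ht, Twist.mk_add_mk]
  have hsnd (w : TensorE M N) : (L w).snd = toCoker w := by
    induction w using induction with
    | hop x y => simp [hop]
    | hbar t => simp [hbar]
    | hadd w w' h h' => rw [map_add, map_add, ← h, ← h']; rfl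
  refine ⟨fun w => (L w).fst, fun w w' => ?_, fun x y => by simp [hop], fun t => by simp [hbar]⟩
  rw [← hsnd, ← hsnd]
  exact congrArg Twist.fst (map_add L w w')

end TensorE

/-! ### The square group structure -/

variable (M N) in
/-- The cross-effect of `H` on the tensor product, defined on the cokernels. -/
def rho : M.Coker ⊗[ℤ] N.Coker →ₗ[ℤ] M.Coker ⊗[ℤ] N.Coker →ₗ[ℤ] M.ee ⊗[ℤ] N.ee :=
  TensorProduct.map₂
    (AddMonoidHom.toIntLinearMap
      ((AddMonoidHom.mk' AddMonoidHom.toIntLinearMap fun _ _ => rfl).comp M.crCoker))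
    (AddMonoidHom.toIntLinearMap
      ((AddMonoidHom.mk' AddMonoidHom.toIntLinearMap fun _ _ => rfl).comp N.crCoker))

@[simp] lemma rho_tmul (x x' : M.e) (y y' : N.e) :
    rho M N (M.cls x ⊗ₜ N.cls y) (M.cls x' ⊗ₜ N.cls y') = M.cr x x' ⊗ₜ N.cr y y' :=
  rfl

variable (M N) in
/-- `rho` as a biadditive map. -/
def rhoHom : M.Coker ⊗[ℤ] N.Coker →+ M.Coker ⊗[ℤ] N.Coker →+ M.ee ⊗[ℤ] N.ee :=
  AddMonoidHom.mk' (fun q => (rho M N q).toAddMonoidHom) fun q q' => by ext; simp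

@[simp] lemma rhoHom_apply (q q' : M.Coker ⊗[ℤ] N.Coker) : rhoHom M N q q' = rho M N q q' := rfl

variable (M N) in
/-- `T ⊗ T`. -/
def TT : M.ee ⊗[ℤ] N.ee →+ M.ee ⊗[ℤ] N.ee :=
  (TensorProduct.map M.THom.toIntLinearMap N.THom.toIntLinearMap).toAddMonoidHom

@[simp] lemma TT_tmul (a : M.ee) (b : N.ee) : TT M N (a ⊗ₜ b) = M.T a ⊗ₜ N.T b := rfl

/-- Twisted lift with `ι` the identity of `M_ee ⊗ N_ee`. The map on the symbols `a ⊗̄ b` is `1 - T ⊗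
T`, and it is compatible with the last relation because `T ⊗ T` is an involution. -/
lemma exists_tensorH (M N : SquareGroup.{u}) : ∃ F : TensorE M N → M.ee ⊗[ℤ] N.ee,
    (∀ w w', F (w + w') = F w + F w' + rho M N (TensorE.toCoker w) (TensorE.toCoker w')) ∧
    (∀ x y, F (op M N x y) = M.cr x x ⊗ₜ N.H y + M.H x ⊗ₜ N.Δ y) ∧
    ∀ t, F (TensorE.barHom t) = t - TT M N t := by
  refine TensorE.exists_twistedLift (AddMonoidHom.id _) (fun a g => add_comm _ _) (rhoHom M N)
    _ (AddMonoidHom.id _ - TT M N) ?_ ?_ ?_ ?_ ?_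
  · intro x y y'
    simp only [H_add, Δ_add, TensorProduct.tmul_add, AddMonoidHom.id_apply, rhoHom_apply, rho_tmul]
    abel
  · intro x x' y
    simp only [H_add, cr_add_left, cr_add_right, TensorProduct.add_tmul, AddMonoidHom.id_apply,
      rhoHom_apply, rho_tmul, AddMonoidHom.sub_apply, TT_tmul, T_cr, TensorProduct.neg_tmul,
      Δ_eq, TensorProduct.tmul_add, TensorProduct.tmul_sub]
    abel
  · intro x b
    simp [H_P, TensorProduct.tmul_add, T_cr, TensorProduct.neg_tmul]
  · intro a y
    simp [H_P, TensorProduct.add_tmul, TensorProduct.tmul_neg]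
  · intro a b
    simp

/-- The map `H` of the tensor product. -/
noncomputable def tensorH (M N : SquareGroup.{u}) : TensorE M N → M.ee ⊗[ℤ] N.ee :=
  (exists_tensorH M N).choose

lemma tensorH_add (w w' : TensorE M N) : tensorH M N (w + w') =
    tensorH M N w + tensorH M N w' + rho M N (TensorE.toCoker w) (TensorE.toCoker w') :=
  (exists_tensorH M N).choose_spec.1 w w'

lemma tensorH_op (x : M.e) (y : N.e) :
    tensorH M N (op M N x y) = M.cr x x ⊗ₜ N.H y + M.H x ⊗ₜ N.Δ y :=
  (exists_tensorH M N).choose_spec.2.1 x y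

lemma tensorH_barHom (t : M.ee ⊗[ℤ] N.ee) : tensorH M N (TensorE.barHom t) = t - TT M N t :=
  (exists_tensorH M N).choose_spec.2.2 t

lemma crossEffect_tensorH (w w' : TensorE M N) : crossEffect (tensorH M N) w w' =
    rho M N (TensorE.toCoker w) (TensorE.toCoker w') := by
  rw [crossEffect, tensorH_add]; abel

/-- The cancellation behind `TensorE.op_add_op`: `h` equates the two expansions of a symbol with a
sum in both variables. -/
lemma eq_add_of_central {G : Type*} [AddGroup G] {a b c d s t r : G}
    (h : a + b + (c + d) + (s + t + r) = a + c + s + (b + d + t)) (hs : ∀ z, s + z = z + s)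
    (hr : ∀ z, r + z = z + r) : c + b = b + c + r := by
  have h₁ : a + b + (c + d) + (s + t + r) = a + (b + c + r) + (d + (s + t)) := by
    rw [add_assoc a (b + c + r), add_assoc (b + c), hr (d + (s + t))]
    simp only [add_assoc]
  have h₂ : a + c + s + (b + d + t) = a + (c + b) + (d + (s + t)) := by
    rw [add_assoc _ s, hs, hs t]
    simp only [add_assoc]
  exact (add_left_cancel (add_right_cancel (h₁.symm.trans (h.trans h₂)))).symm

lemma TensorE.op_add_op (x x' : M.e) (y y' : N.e) : op M N x y + op M N x' y' =
    op M N x' y' + op M N x y + bar M N (M.cr x x') (N.cr y y') := by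
  have h := op_add_right (x' + x) y y'
  rw [op_add_left, op_add_left, op_add_left, H_add, op_add_right, op_add_right, bar_add_right,
    bar_add_right] at h
  exact eq_add_of_central h (bar_central _ _) (bar_central _ _)

/-- The commutator is biadditive because it is central, so the case of two generators `x ⊛ y`
extends to all elements. -/
lemma TensorE.add_comm_barHom (w w' : TensorE M N) :
    w + w' = w' + w + barHom (rho M N (toCoker w) (toCoker w')) := by
  induction w using induction with
  | hbar t => simp [barHom_central]
  | hadd w₁ w₂ h₁ h₂ =>
    rw [map_add, map_add, LinearMap.add_apply, map_add, add_assoc, h₂, ← add_assoc, ← add_assoc, h₁,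
      add_assoc (w' + w₁), barHom_central]
    simp only [add_assoc]
  | hop x y =>
    induction w' using induction with
    | hbar t => simp [barHom_central]
    | hop x' y' => simpa [barHom_tmul] using op_add_op x x' y y'
    | hadd w₁ w₂ h₁ h₂ =>
      rw [map_add, map_add, map_add, ← add_assoc, h₁]
      conv_lhs => rw [add_assoc (w₁ + _), barHom_central, ← add_assoc, add_assoc w₁, h₂]
      simp only [add_assoc]
      rw [barHom_central]

/-- The square group structure on the tensor product. -/
noncomputable def tensorStr (M N : SquareGroup.{u}) :
    SquareStr (TensorE M N) (M.ee ⊗[ℤ] N.ee) where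
  H := tensorH M N
  P := TensorE.barHom
  quadratic := ⟨fun _ _ _ => by simp [crossEffect_tensorH],
    fun _ _ _ => by simp [crossEffect_tensorH]⟩
  cross_P_left a y := by simp [crossEffect_tensorH]
  cross_P_right x b := by simp [crossEffect_tensorH]
  P_cross w w' := by
    have h := TensorE.add_comm_barHom w w'
    rw [crossEffect_tensorH, sub_eq_add_neg, add_assoc, h, ← neg_add_rev, neg_add_cancel_left]
  PHP t := by
    -- The last defining relation says `P(T ⊗ T) = -P`, whence `PHP = P(1 - T ⊗ T) = 2P`.
    have h : TensorE.barHom (TT M N t) = -TensorE.barHom t := by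
      induction t with
      | zero => simp
      | tmul a b => exact TensorE.bar_T a b
      | add s t hs ht => rw [map_add, map_add, hs, ht, ← neg_add_rev, ← map_add, add_comm]
    rw [tensorH_barHom, map_sub, h, sub_neg_eq_add]

end SquareGroup

namespace SquareGroup

variable {M N X : SquareGroup.{u}}

lemma tensorStr_P (a : M.ee) (b : N.ee) : (tensorStr M N).P (a ⊗ₜ b) = bar M N a b := rfl

lemma crossEffect_tensorStr (w w' : TensorE M N) : crossEffect (tensorStr M N).H w w' =
    rho M N (TensorE.toCoker w) (TensorE.toCoker w') := crossEffect_tensorH w w'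

lemma isTensorH_tensorStr (M N : SquareGroup.{u}) : IsTensorH M N (tensorStr M N).H where
  quadratic := (tensorStr M N).quadratic
  cross_op x x' y y' := by simp [crossEffect_tensorStr]
  cross_bar_left a b := (tensorStr M N).cross_P_left (a ⊗ₜ b)
  cross_bar_right a b w := (tensorStr M N).cross_P_right w (a ⊗ₜ b)
  map_op := tensorH_op
  map_bar a b := tensorH_barHom (a ⊗ₜ b)

/-! ### Uniqueness of `H`. -/

lemma _root_.IsQuadratic.cross_zero_left {G A : Type*} [AddGroup G] [AddCommGroup A] {f : G → A}
    (h : IsQuadratic f) (y : G) : crossEffect f 0 y = 0 := by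
  simpa using h.cross_add_left 0 0 y

lemma _root_.IsQuadratic.cross_zero_right {G A : Type*} [AddGroup G] [AddCommGroup A] {f : G → A}
    (h : IsQuadratic f) (y : G) : crossEffect f y 0 = 0 := by
  simpa using h.cross_add_right y 0 0

lemma _root_.IsQuadratic.map_zero {G A : Type*} [AddGroup G] [AddCommGroup A] {f : G → A}
    (h : IsQuadratic f) : f 0 = 0 := by
  simpa [crossEffect] using h.cross_zero_left 0

lemma eq_add_crossEffect {G A : Type*} [AddGroup G] [AddCommGroup A] (f : G → A) (x y : G) :
    f (x + y) = f x + f y + crossEffect f x y := by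
  rw [crossEffect]; abel

namespace IsTensorH

variable {h h' : TensorE M N → M.ee ⊗[ℤ] N.ee}

lemma cross_barHom_left (H : IsTensorH M N h) (t : M.ee ⊗[ℤ] N.ee) (w : TensorE M N) :
    crossEffect h (TensorE.barHom t) w = 0 := by
  induction t with
  | zero => rw [map_zero, H.quadratic.cross_zero_left]
  | tmul a b => exact H.cross_bar_left a b w
  | add s t hs ht => rw [map_add, H.quadratic.cross_add_left, hs, ht, add_zero]

lemma cross_barHom_right (H : IsTensorH M N h) (t : M.ee ⊗[ℤ] N.ee) (w : TensorE M N) :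
    crossEffect h w (TensorE.barHom t) = 0 := by
  induction t with
  | zero => rw [map_zero, H.quadratic.cross_zero_right]
  | tmul a b => exact H.cross_bar_right a b w
  | add s t hs ht => rw [map_add, H.quadratic.cross_add_right, hs, ht, add_zero]

lemma cross_eq (H : IsTensorH M N h) (H' : IsTensorH M N h') (w w' : TensorE M N) :
    crossEffect h w w' = crossEffect h' w w' := by
  induction w using TensorE.induction with
  | hbar t => rw [H.cross_barHom_left, H'.cross_barHom_left]
  | hadd w₁ w₂ h₁ h₂ => rw [H.quadratic.cross_add_left, H'.quadratic.cross_add_left, h₁, h₂]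
  | hop x y =>
    induction w' using TensorE.induction with
    | hbar t => rw [H.cross_barHom_right, H'.cross_barHom_right]
    | hadd w₁ w₂ h₁ h₂ => rw [H.quadratic.cross_add_right, H'.quadratic.cross_add_right, h₁, h₂]
    | hop x' y' => rw [H.cross_op, H'.cross_op]

/-- Uniqueness of the map `H` of the tensor product. -/
lemma unique (H : IsTensorH M N h) (H' : IsTensorH M N h') : h = h' := by
  ext w
  induction w using TensorE.induction with
  | hop x y => rw [H.map_op, H'.map_op]
  | hadd w₁ w₂ h₁ h₂ => rw [eq_add_crossEffect h, eq_add_crossEffect h', h₁, h₂, H.cross_eq H']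
  | hbar t =>
    induction t with
    | zero => rw [map_zero, H.quadratic.map_zero, H'.quadratic.map_zero]
    | tmul a b => exact (H.map_bar a b).trans (H'.map_bar a b).symm
    | add s t hs ht => rw [map_add, eq_add_crossEffect h, eq_add_crossEffect h', hs, ht,
        H.cross_eq H']

end IsTensorH

/-! ### The cokernel of the tensor product -/

/-- The comparison map from the cokernel of `M ⊛ N` to the tensor product of the cokernels. -/
noncomputable def cokerTensorHom (M N : SquareGroup.{u}) :
    (of (tensorStr M N)).Coker →+ M.Coker ⊗[ℤ] N.Coker :=
  Coker.lift (M := of (tensorStr M N)) TensorE.toCoker TensorE.toCoker_barHom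

/-- The inverse of `cokerTensorHom`. -/
noncomputable def cokerTensorInv (M N : SquareGroup.{u}) :
    M.Coker ⊗[ℤ] N.Coker →+ (of (tensorStr M N)).Coker :=
  -- The class of `x ⊛ y` is biadditive and vanishes on values of `P` in either variable, because
  -- every correction in the relations is a value of `P`.
  TensorProduct.liftAddHom
    (Coker.lift
      (AddMonoidHom.mk' (fun x => Coker.lift
          (AddMonoidHom.mk' (fun y => (of (tensorStr M N)).cls (op M N x y)) fun y y' => by
            rw [TensorE.op_add_right]; exact map_add (of (tensorStr M N)).cls _ _)
          fun b => by
            change (of (tensorStr M N)).cls (op M N x (N.P b)) = 0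
            rw [TensorE.op_P]
            exact cls_P (M := of (tensorStr M N)) (M.cr x x ⊗ₜ b)) fun x x' => by
        ext y
        obtain ⟨y, rfl⟩ := cls_surjective y
        change (of (tensorStr M N)).cls (op M N (x + x') y) =
          (of (tensorStr M N)).cls (op M N x y) + (of (tensorStr M N)).cls (op M N x' y)
        rw [TensorE.op_add_left]
        have h : (of (tensorStr M N)).cls (bar M N (M.cr x' x) (N.H y)) = 0 :=
          cls_P (M := of (tensorStr M N)) (M.cr x' x ⊗ₜ N.H y)
        refine (map_add (of (tensorStr M N)).cls _ _).trans ?_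
        rw [h, add_zero]
        exact map_add (of (tensorStr M N)).cls _ _)
      fun a => by
        ext y
        obtain ⟨y, rfl⟩ := cls_surjective y
        change (of (tensorStr M N)).cls (op M N (M.P a) y) = 0
        rw [TensorE.P_op]
        exact cls_P (M := of (tensorStr M N)) (a ⊗ₜ N.Δ y))
    fun r a b => by rw [map_zsmul, map_zsmul]; rfl

/-- The cokernel of `M ⊛ N` is the tensor product of the cokernels. -/
noncomputable def cokerTensorEquiv (M N : SquareGroup.{u}) :
    (of (tensorStr M N)).Coker ≃+ M.Coker ⊗[ℤ] N.Coker :=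
  AddMonoidHom.toAddEquiv (cokerTensorHom M N) (cokerTensorInv M N)
    (by
      ext w
      obtain ⟨w, rfl⟩ := cls_surjective w
      change cokerTensorInv M N (TensorE.toCoker w) = (of (tensorStr M N)).cls w
      induction w using TensorE.induction with
      | hop x y => rw [TensorE.toCoker_op]; rfl
      | hbar t =>
        rw [TensorE.toCoker_barHom, map_zero]; exact (cls_P (M := of (tensorStr M N)) t).symm
      | hadd w w' h h' =>
        rw [map_add, map_add, h, h']; exact (map_add (of (tensorStr M N)).cls _ _).symm)
    (by
      ext t
      change cokerTensorHom M N (cokerTensorInv M N t) = t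
      induction t with
      | zero => simp
      | add s t hs ht => rw [map_add, map_add, hs, ht]
      | tmul x y =>
        obtain ⟨x, rfl⟩ := cls_surjective x
        obtain ⟨y, rfl⟩ := cls_surjective y
        exact TensorE.toCoker_op x y)

/-- The homomorphism inducing the cross-effect of `H` on the tensor product. -/
def rhoTensor (M N : SquareGroup.{u}) :
    (M.Coker ⊗[ℤ] N.Coker) ⊗[ℤ] (M.Coker ⊗[ℤ] N.Coker) →+ M.ee ⊗[ℤ] N.ee :=
  (TensorProduct.lift (rho M N)).toAddMonoidHom

/-! ### Interface of the tensor product -/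

/-- The tensor product of square groups. -/
noncomputable def tensor (M N : SquareGroup.{u}) : SquareGroup.{u} := of (tensorStr M N)

/-- The element `x ⊛ y`. -/
def tmk (x : M.e) (y : N.e) : (tensor M N).e := op M N x y

/-- The biadditive map `(a, b) ↦ a ⊗ b` to the ee-level of the tensor product. -/
noncomputable def tt : M.ee →+ N.ee →+ (tensor M N).ee :=
  (AddMonoidHom.mk' (fun a => (AddMonoidHom.mk' (fun b => a ⊗ₜ b) (TensorProduct.tmul_add a) :
      N.ee →+ M.ee ⊗[ℤ] N.ee))
    fun a a' => AddMonoidHom.ext fun b => TensorProduct.add_tmul a a' b :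
      M.ee →+ N.ee →+ M.ee ⊗[ℤ] N.ee)

lemma tmk_add_right (x : M.e) (y y' : N.e) : tmk x (y + y') = tmk x y + tmk x y' :=
  TensorE.op_add_right x y y'

lemma tmk_add_left (x x' : M.e) (y : N.e) :
    tmk (x + x') y = tmk x y + tmk x' y + (tensor M N).P (tt (M.cr x' x) (N.H y)) :=
  TensorE.op_add_left x x' y

lemma tmk_P (x : M.e) (b : N.ee) : tmk x (N.P b) = (tensor M N).P (tt (M.cr x x) b) :=
  TensorE.op_P x b

lemma P_tmk (a : M.ee) (y : N.e) : tmk (M.P a) y = (tensor M N).P (tt a (N.Δ y)) :=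
  TensorE.P_op a y

lemma H_tmk (x : M.e) (y : N.e) :
    (tensor M N).H (tmk x y) = tt (M.cr x x) (N.H y) + tt (M.H x) (N.Δ y) := tensorH_op x y

lemma cr_tmk (x x' : M.e) (y y' : N.e) :
    (tensor M N).cr (tmk x y) (tmk x' y') = tt (M.cr x x') (N.cr y y') :=
  (isTensorH_tensorStr M N).cross_op x x' y y'

lemma T_tt (a : M.ee) (b : N.ee) : (tensor M N).T (tt a b) = -tt (M.T a) (N.T b) := by
  have h : (tensor M N).H ((tensor M N).P (tt a b)) = tt a b - tt (M.T a) (N.T b) :=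
    tensorH_barHom (a ⊗ₜ b)
  rw [T, h]; abel

/-- Homomorphisms out of the ee-level of the tensor product. -/
noncomputable def eeLift {A : Type*} [AddCommGroup A] (f : M.ee →+ N.ee →+ A) :
    (tensor M N).ee →+ A :=
  (TensorProduct.liftAddHom f fun r a b => by rw [map_zsmul, map_zsmul]; rfl :
    M.ee ⊗[ℤ] N.ee →+ A)

@[simp] lemma eeLift_tt {A : Type*} [AddCommGroup A] (f : M.ee →+ N.ee →+ A) (a : M.ee)
    (b : N.ee) : eeLift f (tt a b) = f a b := rfl

lemma ee_induction {p : (tensor M N).ee → Prop} (hzero : p 0) (htt : ∀ a b, p (tt a b))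
    (hadd : ∀ s t, p s → p t → p (s + t)) (t : (tensor M N).ee) : p t :=
  TensorProduct.induction_on (motive := p) t hzero htt hadd

lemma eeHom_ext {A : Type*} [AddCommGroup A] {f g : (tensor M N).ee →+ A}
    (h : ∀ a b, f (tt a b) = g (tt a b)) : f = g := by
  ext t
  induction t using ee_induction with
  | hzero => simp
  | htt a b => exact h a b
  | hadd s t hs ht => simp [hs, ht]

lemma e_induction {p : (tensor M N).e → Prop} (htmk : ∀ x y, p (tmk x y))
    (hP : ∀ t, p ((tensor M N).P t)) (hadd : ∀ w w', p w → p w' → p (w + w'))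
    (w : (tensor M N).e) : p w :=
  TensorE.induction (p := p) htmk hP hadd w

/-- Maps out of the e-level of the tensor product that are additive up to a multiple of the
cross-effect. -/
lemma exists_twisted (F : (tensor M N).ee →+ X.ee) (f : M.e → N.e → X.e)
    (ψ : M.ee →+ N.ee →+ X.ee)
    (h₄ : ∀ x y y', f x (y + y') = f x y + f x y' + X.P (F (tt (M.cr x x) (N.cr y' y))))
    (h₅ : ∀ x x' y, f (x + x') y = f x y + f x' y
      + X.P (F (tt (M.cr x' x) (N.cr y y))) + X.P (ψ (M.cr x' x) (N.H y)))
    (h₆ : ∀ x b, f x (N.P b) = X.P (ψ (M.cr x x) b))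
    (h₇ : ∀ a y, f (M.P a) y = X.P (ψ a (N.Δ y)))
    (h₈ : ∀ a b, X.P (ψ (M.T a) (N.T b)) = -X.P (ψ a b)) :
    ∃ φ : (tensor M N).e → X.e,
      (∀ w w', φ (w + w') = φ w + φ w' + X.P (F ((tensor M N).cr w' w))) ∧
      (∀ x y, φ (tmk x y) = f x y) ∧ ∀ t, φ ((tensor M N).P t) = X.P (eeLift ψ t) := by
  -- The cocycle is `F` composed with `rho`, arguments swapped to match the order in `(x₂|x₁)_H` of
  -- the left distributivity relation.
  obtain ⟨φ, h₁, h₂, h₃⟩ := TensorE.exists_twistedLift X.P X.P_comm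
    ((AddMonoidHom.mk' (fun q => (AddMonoidHom.comp F ((rhoHom M N).flip q) :
        M.Coker ⊗[ℤ] N.Coker →+ X.ee)) fun q q' => by
      ext t; exact (congrArg F (map_add (rhoHom M N t) q q')).trans (map_add F _ _)))
    f (eeLift ψ) h₄ h₅ h₆ h₇ h₈
  refine ⟨φ, fun w w' => (h₁ w w').trans ?_, h₂, h₃⟩
  exact congrArg (fun z => φ w + φ w' + X.P (F z)) (crossEffect_tensorStr w' w).symm

/-- Homomorphisms out of the e-level of the tensor product. -/
lemma exists_eHom (f : M.e → N.e → X.e) (ψ : (tensor M N).ee →+ X.ee)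
    (h₄ : ∀ x y y', f x (y + y') = f x y + f x y')
    (h₅ : ∀ x x' y, f (x + x') y = f x y + f x' y + X.P (ψ (tt (M.cr x' x) (N.H y))))
    (h₆ : ∀ x b, f x (N.P b) = X.P (ψ (tt (M.cr x x) b)))
    (h₇ : ∀ a y, f (M.P a) y = X.P (ψ (tt a (N.Δ y))))
    (h₈ : ∀ a b, X.P (ψ (tt (M.T a) (N.T b))) = -X.P (ψ (tt a b))) :
    ∃ φ : (tensor M N).e →+ X.e,
      (∀ x y, φ (tmk x y) = f x y) ∧ ∀ t, φ ((tensor M N).P t) = X.P (ψ t) := by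
  obtain ⟨φ, h₁, h₂, h₃⟩ := TensorE.exists_twistedLift X.P X.P_comm 0 f ψ
    (by simpa using h₄) (fun x x' y => (h₅ x x' y).trans (by simp; rfl)) h₆ h₇ h₈
  exact ⟨AddMonoidHom.mk' φ fun w w' => (h₁ w w').trans (by simp), h₂, h₃⟩

end SquareGroup

namespace SquareGroup

variable {M N X : SquareGroup.{u}}

/-! ### Morphisms out of the tensor product -/

/-- Compatibility with `H` spreads from generators: on values of `P` it follows from `HP = Id + T`
and `hT`, and on sums from the cross-effect, which is biadditive and kills values of `P`. By `PT =
P`, `hT` also yields the last defining relation. -/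
lemma exists_hom (f : M.e → N.e → X.e) (ψ : (tensor M N).ee →+ X.ee)
    (h₄ : ∀ x y y', f x (y + y') = f x y + f x y')
    (h₅ : ∀ x x' y, f (x + x') y = f x y + f x' y + X.P (ψ (tt (M.cr x' x) (N.H y))))
    (h₆ : ∀ x b, f x (N.P b) = X.P (ψ (tt (M.cr x x) b)))
    (h₇ : ∀ a y, f (M.P a) y = X.P (ψ (tt a (N.Δ y))))
    (hT : ∀ a b, X.T (ψ (tt a b)) = -ψ (tt (M.T a) (N.T b)))
    (hcr : ∀ x x' y y', X.cr (f x y) (f x' y') = ψ (tt (M.cr x x') (N.cr y y')))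
    (hH : ∀ x y, X.H (f x y) = ψ (tt (M.cr x x) (N.H y)) + ψ (tt (M.H x) (N.Δ y))) :
    ∃ φ : tensor M N ⟶ X, (∀ x y, φ.e (tmk x y) = f x y) ∧ φ.ee = ψ := by
  obtain ⟨φ, hφ, hP⟩ := exists_eHom f ψ h₄ h₅ h₆ h₇ fun a b => by
    rw [← neg_eq_iff_eq_neg, ← map_neg, ← hT, P_T]
  have hT' (t : (tensor M N).ee) : X.T (ψ t) = ψ ((tensor M N).T t) := by
    have h : X.THom.comp ψ = ψ.comp (tensor M N).THom := eeHom_ext fun a b => by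
      simp only [AddMonoidHom.comp_apply, THom_apply, hT, T_tt, map_neg]
    exact DFunLike.congr_fun h t
  have hcr' (w w' : (tensor M N).e) : X.cr (φ w) (φ w') = ψ ((tensor M N).cr w w') := by
    induction w using e_induction with
    | hP t => simp [hP]
    | hadd w₁ w₂ h₁ h₂ => simp only [map_add, cr_add_left, h₁, h₂]
    | htmk x y =>
      induction w' using e_induction with
      | hP t => simp [hP]
      | hadd w₁ w₂ h₁ h₂ => simp only [map_add, cr_add_right, h₁, h₂]
      | htmk x' y' => rw [hφ, hφ, hcr, cr_tmk]
  refine ⟨⟨φ, ψ, fun w => ?_, hP⟩, hφ, rfl⟩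
  induction w using e_induction with
  | htmk x y => rw [hφ, hH, H_tmk, map_add]
  | hP t => rw [hP, H_P, H_P, hT', map_add]
  | hadd w₁ w₂ h₁ h₂ => rw [map_add, H_add, H_add, map_add, map_add, h₁, h₂, hcr']

lemma tensor_hom_ext {f g : tensor M N ⟶ X} (he : ∀ x y, f.e (tmk x y) = g.e (tmk x y))
    (hee : f.ee = g.ee) : f = g := by
  ext w
  · induction w using e_induction with
    | htmk x y => exact he x y
    | hP t => rw [f.map_P, g.map_P, hee]
    | hadd w w' h h' => rw [map_add, map_add, h, h']
  · rw [hee]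

section Nested

variable {A B C D : SquareGroup.{u}}

/-- Although `w ↦ w ⊛ z` is not additive, its defect is a value of `P`, where `f` and `g` agree as
soon as their ee-parts do. -/
lemma tmk_tensor_induction_left (f g : tensor (tensor A B) C ⟶ X) (hee : f.ee = g.ee) (z : C.e)
    (h : ∀ x y, f.e (tmk (tmk x y) z) = g.e (tmk (tmk x y) z)) (w : (tensor A B).e) :
    f.e (tmk w z) = g.e (tmk w z) := by
  induction w using e_induction with
  | htmk x y => exact h x y
  | hP t => simp only [P_tmk, Hom.map_P, hee]
  | hadd w w' h h' => simp only [tmk_add_left, Hom.map_P, map_add, h, h', hee]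

lemma tensor_hom_ext_left {f g : tensor (tensor A B) C ⟶ X}
    (he : ∀ x y z, f.e (tmk (tmk x y) z) = g.e (tmk (tmk x y) z))
    (hee : f.ee = g.ee) : f = g :=
  tensor_hom_ext (fun w z => tmk_tensor_induction_left f g hee z (he · · z) w) hee

lemma tensor_hom_ext_right {f g : tensor A (tensor B C) ⟶ X}
    (he : ∀ x y z, f.e (tmk x (tmk y z)) = g.e (tmk x (tmk y z)))
    (hee : f.ee = g.ee) : f = g := by
  refine tensor_hom_ext (fun x w => ?_) hee
  induction w using e_induction with
  | htmk y z => exact he x y z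
  | hP t => simp only [tmk_P, Hom.map_P, hee]
  | hadd w w' h h' => simp only [tmk_add_right, map_add, h, h']

lemma tensor_hom_ext_left_left {f g : tensor (tensor (tensor A B) C) D ⟶ X}
    (he : ∀ x y z w, f.e (tmk (tmk (tmk x y) z) w) = g.e (tmk (tmk (tmk x y) z) w))
    (hee : f.ee = g.ee) : f = g := by
  refine tensor_hom_ext_left (fun v z w => ?_) hee
  induction v using e_induction with
  | htmk x y => exact he x y z w
  | hP t => simp only [P_tmk, Hom.map_P, hee]
  | hadd v v' h h' =>
    simp only [tmk_add_left, Hom.map_P, map_add, h, h', hee, P_tmk]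

lemma eeHom_ext_left {G : Type*} [AddCommGroup G] {f g : (tensor (tensor A B) C).ee →+ G}
    (h : ∀ a b c, f (tt (tt a b) c) = g (tt (tt a b) c)) : f = g := by
  refine eeHom_ext fun t c => ?_
  induction t using ee_induction with
  | hzero => simp
  | htt a b => exact h a b c
  | hadd s t hs ht => simp [hs, ht]

lemma eeHom_ext_right {G : Type*} [AddCommGroup G] {f g : (tensor A (tensor B C)).ee →+ G}
    (h : ∀ a b c, f (tt a (tt b c)) = g (tt a (tt b c))) : f = g := by
  refine eeHom_ext fun a t => ?_
  induction t using ee_induction with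
  | hzero => simp
  | htt b c => exact h a b c
  | hadd s t hs ht => simp [hs, ht]

lemma eeHom_ext_left_left {G : Type*} [AddCommGroup G]
    {f g : (tensor (tensor (tensor A B) C) D).ee →+ G}
    (h : ∀ a b c d, f (tt (tt (tt a b) c) d) = g (tt (tt (tt a b) c) d)) : f = g := by
  refine eeHom_ext_left fun t c d => ?_
  induction t using ee_induction with
  | hzero => simp
  | htt a b => exact h a b c d
  | hadd s t hs ht => simp [hs, ht]

end Nested

/-! ### The operators on pure tensors. -/

lemma P_tt_T (a : M.ee) (b : N.ee) :
    (tensor M N).P (tt (M.T a) (N.T b)) = -(tensor M N).P (tt a b) := by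
  rw [← neg_eq_iff_eq_neg, ← map_neg, ← T_tt, P_T]

lemma P_tt_T_right (a : M.ee) (b : N.ee) :
    (tensor M N).P (tt a (N.T b)) = -(tensor M N).P (tt (M.T a) b) := by
  rw [← P_tt_T, T_T]

-- This multiplicativity makes `P(a) ⊛ (y ⊛ z)` equal to `a ⊗̄ (Δy ⊗ Δz)`, as the associator
-- requires.
@[simp] lemma Δ_tmk (x : M.e) (y : N.e) : (tensor M N).Δ (tmk x y) = tt (M.Δ x) (N.Δ y) := by
  simp only [Δ_eq, H_tmk, T_add, T_sub, T_tt, T_cr, cr_tmk, map_neg, map_add, map_sub,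
    AddMonoidHom.neg_apply, AddMonoidHom.add_apply, AddMonoidHom.sub_apply, T_T]
  abel

/-! ### Functoriality -/

section Map

variable {M' N' M'' N'' : SquareGroup.{u}}

lemma exists_tmap (f : M ⟶ M') (g : N ⟶ N') : ∃ φ : tensor M N ⟶ tensor M' N',
    (∀ x y, φ.e (tmk x y) = tmk (f.e x) (g.e y)) ∧
      φ.ee = eeLift ((tt.comp f.ee).compl₂ g.ee) := by
  refine exists_hom _ _ ?_ ?_ ?_ ?_ ?_ ?_ ?_ <;> intros <;>
    simp only [map_add, tmk_add_left, tmk_add_right, Hom.map_P, tmk_P, P_tmk, eeLift_tt,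
      AddMonoidHom.compl₂_apply, AddMonoidHom.comp_apply, Hom.map_cr, Hom.map_H, Hom.map_Δ, T_tt,
      Hom.map_T, cr_tmk, H_tmk]

/-- The action of the tensor product on morphisms. -/
noncomputable def tmap (f : M ⟶ M') (g : N ⟶ N') : tensor M N ⟶ tensor M' N' :=
  (exists_tmap f g).choose

@[simp] lemma tmap_e (f : M ⟶ M') (g : N ⟶ N') (x : M.e) (y : N.e) :
    (tmap f g).e (tmk x y) = tmk (f.e x) (g.e y) := (exists_tmap f g).choose_spec.1 x y

@[simp] lemma tmap_ee (f : M ⟶ M') (g : N ⟶ N') (a : M.ee) (b : N.ee) :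
    (tmap f g).ee (tt a b) = tt (f.ee a) (g.ee b) := by
  rw [tmap, (exists_tmap f g).choose_spec.2]; rfl

lemma tmap_id (M N : SquareGroup.{u}) : tmap (𝟙 M) (𝟙 N) = 𝟙 (tensor M N) :=
  tensor_hom_ext (by simp) (eeHom_ext (by simp))

lemma tmap_comp (f : M ⟶ M') (f' : M' ⟶ M'') (g : N ⟶ N') (g' : N' ⟶ N'') :
    tmap (f ≫ f') (g ≫ g') = tmap f g ≫ tmap f' g' :=
  tensor_hom_ext (by simp) (eeHom_ext (by simp))

end Map

/-! ### Commutativity -/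

section

variable (M)

lemma add_P_add_add_P (x y : M.e) (a b : M.ee) :
    x + M.P a + (y + M.P b) = x + y + M.P (a + b) := by
  rw [map_add, add_assoc, ← add_assoc (M.P a), P_comm]; simp only [add_assoc]

lemma sub_P (x : M.e) (a : M.ee) : x - M.P a = x + M.P (-a) := by
  rw [map_neg, sub_eq_add_neg]

lemma add_P_add_P (x : M.e) (a b : M.ee) : x + M.P a + M.P b = x + M.P (a + b) := by
  rw [map_add, add_assoc]

variable {M}

/-- Each use supplies a witness `c` for which the remaining identity in the ee-level is linear. -/
lemma P_eq_of_eq_add {a b : M.ee} (c : M.ee) (h : a = b + (M.T c - c)) : M.P a = M.P b := by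
  rw [h]; simp

end

/-- The symbol is additive in its right variable but not in its left one, so the plain swap fails.
The left defect `(y'|y) ⊗ H x` has the same image under `P` as `(y|y') ⊗ TH x`, the cross-effect in
`y` of `H y ⊗ TH x`; subtracting this term repairs additivity. -/
lemma exists_braid (M N : SquareGroup.{u}) : ∃ φ : tensor M N ⟶ tensor N M,
    (∀ x y, φ.e (tmk x y) = tmk y x - (tensor N M).P (tt (N.H y) (M.T (M.H x)))) ∧
      φ.ee = eeLift tt.flip := by
  simp only [sub_P]
  refine exists_hom _ _ ?_ ?_ ?_ ?_ ?_ ?_ ?_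
  · intro x y y'
    rw [tmk_add_left, add_P_add_add_P, add_P_add_P]
    -- For this `c`, `T c = (y'|y) ⊗ H x`, so `T c - c` is the defect of the symbol minus that of
    -- the correction.
    refine congrArg _ (P_eq_of_eq_add (tt (N.cr y y') (M.T (M.H x))) ?_)
    simp only [H_add, map_add, AddMonoidHom.add_apply, T_tt, T_cr, map_neg, AddMonoidHom.neg_apply,
      T_T]
    abel
  · intro x x' y
    rw [tmk_add_right, add_P_add_add_P, add_P_add_P]
    simp only [H_add, map_add, T_add, T_cr, map_neg, eeLift_tt, AddMonoidHom.flip_apply, neg_add,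
      neg_neg]
  · intro x b
    rw [P_tmk, ← map_add]
    refine P_eq_of_eq_add (tt b (M.H x)) ?_
    simp only [Δ_eq, H_P, map_add, map_sub, AddMonoidHom.add_apply, T_tt, eeLift_tt,
      AddMonoidHom.flip_apply]
    abel
  · intro a y
    rw [tmk_P, ← map_add]
    refine P_eq_of_eq_add (tt (N.T (N.H y)) a) ?_
    simp only [Δ_eq, H_P, map_add, map_sub, T_tt, eeLift_tt, T_T, T_add, AddMonoidHom.flip_apply]
    abel
  · intro a b
    simp [T_tt]
  · intro x x' y y'
    simp [-map_neg, cr_add_left, cr_add_right, cr_tmk]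
  · intro x y
    rw [H_add_P, H_P, H_tmk]
    simp only [T_neg, T_tt, Δ_eq, map_add, map_sub, T_T, eeLift_tt, AddMonoidHom.flip_apply]
    abel

/-- The commutativity morphism. -/
noncomputable def braid (M N : SquareGroup.{u}) : tensor M N ⟶ tensor N M := (exists_braid M N).choose

@[simp] lemma braid_e (x : M.e) (y : N.e) : (braid M N).e (tmk x y) =
    tmk y x - (tensor N M).P (tt (N.H y) (M.T (M.H x))) := (exists_braid M N).choose_spec.1 x y

@[simp] lemma braid_ee (a : M.ee) (b : N.ee) : (braid M N).ee (tt a b) = tt b a := by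
  rw [braid, (exists_braid M N).choose_spec.2]; rfl

/-- The two corrections cancel since `P(a ⊗ T b) = -P(T a ⊗ b)`. -/
lemma braid_braid (M N : SquareGroup.{u}) : braid M N ≫ braid N M = 𝟙 (tensor M N) := by
  refine tensor_hom_ext (fun x y => ?_) (eeHom_ext (by simp))
  rw [comp_e, braid_e, map_sub, Hom.map_P, braid_e, braid_ee, P_tt_T_right, id_e, sub_neg_eq_add,
    add_sub_cancel_right]

lemma braid_naturality {M' N' : SquareGroup.{u}} (f : M ⟶ M') (g : N ⟶ N') :
    tmap f g ≫ braid M' N' = braid M N ≫ tmap g f :=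
  tensor_hom_ext (by simp [Hom.map_P, Hom.map_H, Hom.map_T]) (eeHom_ext (by simp))

/-! ### The unit -/

/-- Induction on integers in a noncommutative group: equal right increments settle negative
arguments too, by cancellation. -/
lemma eq_of_step {G : Type*} [AddGroup G] {g h s : ℤ → G} (h₀ : g 0 = h 0)
    (hg : ∀ n, g (n + 1) = g n + s n) (hh : ∀ n, h (n + 1) = h n + s n) (n : ℤ) : g n = h n := by
  induction n using Int.induction_on with
  | zero => exact h₀
  | succ n ih => rw [hg, hh, ih]
  | pred n ih =>
    have h₁ := hg (-n - 1)
    have h₂ := hh (-n - 1)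
    rw [sub_add_cancel] at h₁ h₂
    exact add_right_cancel (h₁.symm.trans (ih.trans h₂))

lemma triangular_succ (n : ℤ) : (n + 1) * (n + 1 - 1) / 2 = n * (n - 1) / 2 + n := by
  rw [show (n + 1) * (n + 1 - 1) = n * (n - 1) + n * 2 by ring, Int.add_mul_ediv_right _ _ two_ne_zero]

variable (M) in
-- The power formula for nilpotency class two; its binomial coefficient is the `H` of `ℤ_nil`.
lemma zsmul_add_eq (n : ℤ) (x y : M.e) :
    n • (x + y) = n • x + n • y + M.P ((n * (n - 1) / 2) • M.cr y x) := by
  refine eq_of_step (g := fun n : ℤ => n • (x + y))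
    (h := fun n : ℤ => n • x + n • y + M.P ((n * (n - 1) / 2) • M.cr y x)) (s := fun _ => x + y) (by simp)
    (fun n => add_one_zsmul _ _) (fun n => ?_) n
  simp only [add_one_zsmul, triangular_succ, add_smul]
  rw [add_assoc (n • x + n • y), P_comm, add_assoc (n • x) (n • y), ← add_assoc (n • y) (x + y),
    ← add_assoc (n • y) x, M.add_comm_P (n • y) x, cr_zsmul_left, map_add,
    add_assoc (x + n • y), P_comm M (n • M.cr y x) y, P_comm M ((n * (n - 1) / 2) • M.cr y x)]
  simp only [add_assoc]

variable (M) in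
lemma H_zsmul (n : ℤ) (x : M.e) :
    M.H (n • x) = n • M.H x + (n * (n - 1) / 2) • M.cr x x := by
  refine eq_of_step (g := fun n : ℤ => M.H (n • x))
    (h := fun n : ℤ => n • M.H x + (n * (n - 1) / 2) • M.cr x x) (s := fun n => M.H x + n • M.cr x x) (by simp)
    (fun n => ?_) (fun n => ?_) n
  · rw [add_one_zsmul, H_add, cr_zsmul_left, add_assoc]
  · simp only [triangular_succ, add_smul, one_smul]; abel

/-- The underlying integer of an element of the e-level of `ℤ_nil`. -/
def zde : Znil.{u}.e →+ ℤ := (AddEquiv.ulift : ULift.{u} ℤ ≃+ ℤ).toAddMonoidHom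

/-- The underlying integer of an element of the ee-level of `ℤ_nil`. -/
def zdee : Znil.{u}.ee →+ ℤ := (AddEquiv.ulift : ULift.{u} ℤ ≃+ ℤ).toAddMonoidHom

lemma zdee_H (n : Znil.{u}.e) : zdee (Znil.H n) = zde n * (zde n - 1) / 2 := rfl

lemma Znil_P (a : Znil.{u}.ee) : Znil.P a = 0 := rfl

lemma zdee_cr (m n : Znil.{u}.e) : zdee (Znil.cr m n) = zde m * zde n := by
  have h : (zde m + zde n) * (zde m + zde n - 1) =
      zde m * (zde m - 1) + zde n * (zde n - 1) + 2 * (zde m * zde n) := by ring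
  have hm := (Int.even_mul_pred_self (zde m)).two_dvd
  have hn := (Int.even_mul_pred_self (zde n)).two_dvd
  simp only [cr, crossEffect, map_sub, zdee_H, map_add, h]
  omega

lemma zdee_T (a : Znil.{u}.ee) : zdee (Znil.T a) = -zdee a := by
  simp [T, Znil_P]

lemma zdee_Δ (n : Znil.{u}.e) : zdee (Znil.Δ n) = zde n := by
  have hn := (Int.even_mul_pred_self (zde n)).two_dvd
  have h : zde n * zde n = zde n * (zde n - 1) + zde n := by ring
  simp only [Δ_eq, map_sub, map_add, zdee_cr, zdee_T, zdee_H, h]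
  omega

/-- On `ℤ_nil`, `T` is `-1`, `Δ` is the identity and `P` is zero. Left distributivity becomes
`zsmul_add_eq`, and the relation for `x ⊛ P(b)` becomes `P(x|x) = 0`. -/
lemma exists_rightUnit (M : SquareGroup.{u}) : ∃ φ : tensor M Znil ⟶ M,
    (∀ x n, φ.e (tmk x n) = zde n • x) ∧
      φ.ee = eeLift ((smulAddHom ℤ M.ee).flip.compl₂ zdee) := by
  have h (a : M.ee) (n : Znil.{u}.ee) :
      eeLift ((smulAddHom ℤ M.ee).flip.compl₂ zdee) (tt a n) = zdee n • a := rfl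
  refine exists_hom _ _ ?_ ?_ ?_ ?_ ?_ ?_ ?_ <;> intros <;> try simp only [h]
  · rw [map_add, add_zsmul]
  · rw [zsmul_add_eq, zdee_H]
  · rw [Znil_P, map_zero, zero_smul, map_zsmul, P_cr_self, smul_zero]
  · rw [zdee_Δ, map_zsmul]
  · rw [zdee_T, neg_smul, neg_neg, ← THom_apply, ← THom_apply, map_zsmul]
  · rw [cr_zsmul_left, cr_zsmul_right, zdee_cr, mul_smul]
  · rw [H_zsmul, zdee_Δ, zdee_H, add_comm]

/-- The right unit morphism. -/
noncomputable def rightUnit (M : SquareGroup.{u}) : tensor M Znil ⟶ M := (exists_rightUnit M).choose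

@[simp] lemma rightUnit_e (x : M.e) (n : Znil.{u}.e) : (rightUnit M).e (tmk x n) = zde n • x :=
  (exists_rightUnit M).choose_spec.1 x n

@[simp] lemma rightUnit_ee (a : M.ee) (n : Znil.{u}.ee) : (rightUnit M).ee (tt a n) = zdee n • a := by
  rw [rightUnit, (exists_rightUnit M).choose_spec.2]; rfl

/-- The unit integer in the e-level of `ℤ_nil`. -/
def oneE : Znil.{u}.e := (⟨1⟩ : ULift.{u} ℤ)

/-- The unit integer in the ee-level of `ℤ_nil`. -/
def oneEE : Znil.{u}.ee := (⟨1⟩ : ULift.{u} ℤ)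

lemma zde_oneE : zde oneE.{u} = 1 := rfl
lemma zdee_oneEE : zdee oneEE.{u} = 1 := rfl
lemma H_oneE : Znil.H oneE.{u} = 0 := rfl
lemma Δ_oneE : Znil.Δ oneE.{u} = oneEE := ULift.ext _ _ (zdee_Δ oneE)
lemma zde_smul_oneE (n : Znil.{u}.e) : zde n • oneE = n := ULift.ext _ _ <| by
  change zde (zde n • oneE) = zde n
  rw [map_zsmul, zde_oneE, smul_eq_mul, mul_one]

lemma zdee_smul_oneEE (n : Znil.{u}.ee) : zdee n • oneEE = n := ULift.ext _ _ <| by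
  change zdee (zdee n • oneEE) = zdee n
  rw [map_zsmul, zdee_oneEE, smul_eq_mul, mul_one]

/-- The inverse of the right unit morphism. -/
noncomputable def rightUnitInv (M : SquareGroup.{u}) : M ⟶ tensor M Znil where
  -- Additive because `H(1) = 0`; compatibility with `P` below uses `Δ(1) = 1`.
  e := AddMonoidHom.mk' (fun x => tmk x oneE) fun x y => by simp [tmk_add_left, H_oneE]
  ee := tt.flip oneEE
  map_H x := by simp [H_tmk, H_oneE, Δ_oneE]
  map_P a := by simp [P_tmk, Δ_oneE]

@[simp] lemma rightUnitInv_e (x : M.e) : (rightUnitInv M).e x = tmk x oneE := rfl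
@[simp] lemma rightUnitInv_ee (a : M.ee) : (rightUnitInv M).ee a = tt a oneEE := rfl

lemma tmk_zsmul_right (n : ℤ) (x : M.e) (y : N.e) : tmk x (n • y) = n • tmk x y :=
  map_zsmul (AddMonoidHom.mk' (tmk x) (tmk_add_right x)) n y

/-- The right unit isomorphism. -/
noncomputable def rightUnitIso (M : SquareGroup.{u}) : tensor M Znil ≅ M where
  hom := rightUnit M
  inv := rightUnitInv M
  hom_inv_id := tensor_hom_ext
    (fun x n => by
      simp only [comp_e, rightUnit_e, map_zsmul, rightUnitInv_e, ← tmk_zsmul_right, zde_smul_oneE,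
        id_e])
    (eeHom_ext fun a n => by
      simp only [comp_ee, rightUnit_ee, map_zsmul, rightUnitInv_ee, id_ee]
      rw [← map_zsmul, zdee_smul_oneEE])
  inv_hom_id := by ext x <;> simp [zde_oneE, zdee_oneEE]

/-- The commutativity isomorphism. -/
noncomputable def braidIso (M N : SquareGroup.{u}) : tensor M N ≅ tensor N M :=
  ⟨braid M N, braid N M, braid_braid M N, braid_braid N M⟩

/-- The left unit isomorphism. -/
noncomputable def leftUnitIso (M : SquareGroup.{u}) : tensor Znil M ≅ M :=
  braidIso Znil M ≪≫ rightUnitIso M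

lemma leftUnitIso_e (n : Znil.{u}.e) (x : M.e) : (leftUnitIso M).hom.e (tmk n x) =
    zde n • x + M.P ((zde n * (zde n - 1) / 2) • M.H x) := by
  change (rightUnit M).e ((braid Znil M).e (tmk n x)) = _
  rw [braid_e, map_sub, Hom.map_P, rightUnit_e, rightUnit_ee, zdee_T, zdee_H, sub_P, neg_smul,
    neg_neg]

lemma leftUnitIso_ee (n : Znil.{u}.ee) (a : M.ee) :
    (leftUnitIso M).hom.ee (tt n a) = zdee n • a := by
  change (rightUnit M).ee ((braid Znil M).ee (tt n a)) = _
  rw [braid_ee, rightUnit_ee]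

end SquareGroup

namespace SquareGroup

lemma add_add_add_comm_P (M : SquareGroup.{u}) (a b c d : M.e) :
    a + b + (c + d) = a + c + (b + d) + M.P (M.cr b c) := by
  rw [add_assoc a b, ← add_assoc b c, add_comm_P M b c, add_assoc (c + b), P_comm]
  simp only [add_assoc]

variable {A B C : SquareGroup.{u}}

/-! ### Associativity -/

variable (A B C) in
/-- The trilinear map `a ⊗ (b ⊗ c)`. -/
noncomputable def tt₃ : A.ee →+ B.ee →+ C.ee →+ (tensor A (tensor B C)).ee :=
  AddMonoidHom.mk' (fun a => AddMonoidHom.mk' (fun b => (tt a).comp (tt b))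
      fun b b' => by ext c; simp)
    fun a a' => by ext b c; simp

@[simp] lemma tt₃_apply (a : A.ee) (b : B.ee) (c : C.ee) : tt₃ A B C a b c = tt a (tt b c) := rfl

variable (A B C) in
/-- The associativity map on the ee-level. -/
noncomputable def assocEE : (tensor (tensor A B) C).ee →+ (tensor A (tensor B C)).ee :=
  eeLift (eeLift (tt₃ A B C))

@[simp] lemma assocEE_tt (a : A.ee) (b : B.ee) (c : C.ee) :
    assocEE A B C (tt (tt a b) c) = tt a (tt b c) := rfl

lemma T_assocEE (t : (tensor (tensor A B) C).ee) :
    (tensor A (tensor B C)).T (assocEE A B C t) =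
      assocEE A B C ((tensor (tensor A B) C).T t) := by
  refine DFunLike.congr_fun (f := (tensor A (tensor B C)).THom.comp (assocEE A B C))
    (g := (assocEE A B C).comp (tensor (tensor A B) C).THom) (eeHom_ext_left fun a b c => ?_) t
  simp [THom_apply, T_tt]

/-- For fixed `z` the defect of `w ↦ w ⊛ z` factors through the cross-effect, so the twisted
universal property applies. -/
lemma exists_assoc_op (z : C.e) : ∃ φ : (tensor A B).e → (tensor A (tensor B C)).e,
    (∀ w w', φ (w + w') = φ w + φ w' + (tensor A (tensor B C)).P
      (assocEE A B C (tt ((tensor A B).cr w' w) (C.H z)))) ∧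
    (∀ x y, φ (tmk x y) = tmk x (tmk y z)) ∧
    ∀ t, φ ((tensor A B).P t) = (tensor A (tensor B C)).P (assocEE A B C (tt t (C.Δ z))) := by
  obtain ⟨φ, h₁, h₂, h₃⟩ := exists_twisted (M := A) (N := B) (X := tensor A (tensor B C))
    ((assocEE A B C).comp (tt.flip (C.H z))) (fun x y => tmk x (tmk y z))
    ((AddMonoidHom.mk' (fun a => (tt a).comp (tt.flip (C.Δ z))) fun a a' => by ext b; simp))
    (fun x y y' => by simp [tmk_add_left, tmk_add_right, tmk_P])
    (fun x x' y => by simp [tmk_add_left, H_tmk, add_assoc])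
    (fun x b => by simp [P_tmk, tmk_P])
    (fun a y => by simp [P_tmk])
    -- `T` on `B ⊛ C` contributes a sign, which `TΔ = -Δ` compensates.
    (fun a b => by
      simp only [AddMonoidHom.mk'_apply, AddMonoidHom.comp_apply, AddMonoidHom.flip_apply]
      rw [← P_tt_T, T_tt, T_Δ]; simp)
  refine ⟨φ, h₁, h₂, fun t => (h₃ t).trans ?_⟩
  congr 1
  refine DFunLike.congr_fun (g := (assocEE A B C).comp (tt.flip (C.Δ z)))
    (eeHom_ext fun a b => ?_) t
  simp

lemma exists_assoc (A B C : SquareGroup.{u}) :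
    ∃ φ : tensor (tensor A B) C ⟶ tensor A (tensor B C),
      (∀ x y z, φ.e (tmk (tmk x y) z) = tmk x (tmk y z)) ∧ φ.ee = assocEE A B C := by
  choose φ hadd hop hP using fun z => exists_assoc_op (A := A) (B := B) (C := C) z
  have hcr (w w' z z') : (tensor A (tensor B C)).cr (φ z w) (φ z' w') =
      assocEE A B C (tt ((tensor A B).cr w w') (C.cr z z')) := by
    induction w using e_induction with
    | hP t => simp [hP]
    | hadd w₁ w₂ h₁ h₂ => simp [hadd, cr_add_left, h₁, h₂]
    | htmk x y =>
      induction w' using e_induction with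
      | hP t => simp [hP]
      | hadd w₁ w₂ h₁ h₂ => simp [hadd, cr_add_right, h₁, h₂]
      | htmk x' y' => simp [hop, cr_tmk]
  refine (exists_hom (M := tensor A B) (N := C) (fun w z => φ z w) (assocEE A B C) ?_
    (fun w w' z => hadd z w w') ?_ (fun t z => hP z t) ?_ (fun w w' z z' => hcr w w' z z') ?_).imp
    fun α h => ⟨fun x y z => (h.1 _ _).trans (hop z x y), h.2⟩
  · intro w z z'
    induction w using e_induction with
    | htmk x y => simp [hop, tmk_add_right]
    | hP t => simp [hP, Δ_add]
    | hadd w w' h h' =>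
      rw [hadd, hadd, hadd, h, h', add_P_add_add_P, add_add_add_comm_P, hcr, add_P_add_P]
      -- Reordering the middle summands produces `(w|w') ⊗ (z'|z)`, and expanding `H (z + z')`
      -- produces `(w'|w) ⊗ (z|z')`. Together they are `T c - c` for this `c`.
      refine congrArg _ (P_eq_of_eq_add
        (-assocEE A B C (tt ((tensor A B).cr w w') (C.cr z' z))) ?_)
      simp only [T_neg, T_assocEE, T_tt, T_cr, H_add, map_add, map_neg, AddMonoidHom.neg_apply]
      abel
  · intro w c
    induction w using e_induction with
    | htmk x y => simp [hop, tmk_P, cr_tmk]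
    | hP t => simp [hP]
    | hadd w w' h h' =>
      rw [hadd, h, h', ← map_add, ← map_add]
      -- The sum in `w` leaves `(w'|w) ⊗ T c` against `(w|w') ⊗ c`; `T` carries the latter to the
      -- former.
      refine P_eq_of_eq_add (assocEE A B C (tt ((tensor A B).cr w w') c)) ?_
      simp only [T_assocEE, T_tt, T_cr, cr_add_left, cr_add_right, H_P, map_add, map_neg,
        AddMonoidHom.add_apply, AddMonoidHom.neg_apply]
      abel
  · intro t c
    rw [T_assocEE, T_tt, map_neg]
  · intro w z
    induction w using e_induction with
    | htmk x y => simp [hop, H_tmk, cr_tmk, add_assoc]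
    | hP t => 
      simp [hP, H_P, T_assocEE, T_tt]
    | hadd w w' h h' =>
      rw [hadd, H_add_P, H_P, H_add, h, h', hcr, T_assocEE, T_tt, T_cr]
      simp only [H_add, cr_add_left, cr_add_right, map_add, map_sub, map_neg,
        AddMonoidHom.add_apply, AddMonoidHom.neg_apply, Δ_eq]
      abel

end SquareGroup

namespace SquareGroup

variable {A B C D : SquareGroup.{u}}

/-- The associativity morphism. -/
noncomputable def assocHom (A B C : SquareGroup.{u}) :
    tensor (tensor A B) C ⟶ tensor A (tensor B C) := (exists_assoc A B C).choose

@[simp] lemma assocHom_ee (t : (tensor (tensor A B) C).ee) :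
    (assocHom A B C).ee t = assocEE A B C t :=
  DFunLike.congr_fun (exists_assoc A B C).choose_spec.2 t

@[simp] lemma assocHom_e (x : A.e) (y : B.e) (z : C.e) :
    (assocHom A B C).e (tmk (tmk x y) z) = tmk x (tmk y z) :=
  (exists_assoc A B C).choose_spec.1 x y z

/-- The inverse of the associativity morphism. -/
noncomputable def assocInv (A B C : SquareGroup.{u}) :
    tensor A (tensor B C) ⟶ tensor (tensor A B) C :=
  -- Reversing the order of the factors turns the associator around, so no second construction on
  -- generators is needed.
  braid A (tensor B C) ≫ tmap (braid B C) (𝟙 A) ≫ assocHom C B A ≫ braid C (tensor B A) ≫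
    tmap (braid B A) (𝟙 C)

@[simp] lemma assocInv_ee (a : A.ee) (b : B.ee) (c : C.ee) :
    (assocInv A B C).ee (tt a (tt b c)) = tt (tt a b) c := by
  simp [assocInv]

lemma tmk_add_P_left (x : A.e) (a : A.ee) (y : B.e) :
    tmk (x + A.P a) y = tmk x y + (tensor A B).P (tt a (B.Δ y)) := by
  simp [tmk_add_left, P_tmk]

lemma tmk_add_P_right (x : A.e) (y : B.e) (b : B.ee) :
    tmk x (y + B.P b) = tmk x y + (tensor A B).P (tt (A.cr x x) b) := by
  rw [tmk_add_right, tmk_P]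

lemma Hom.map_add_P (f : A ⟶ B) (x : A.e) (a : A.ee) :
    f.e (x + A.P a) = f.e x + B.P (f.ee a) := by
  rw [map_add, f.map_P]

lemma braid_e_add (x : A.e) (y : B.e) : (braid A B).e (tmk x y) =
    tmk y x + (tensor B A).P (-tt (B.H y) (A.T (A.H x))) := by
  rw [braid_e, sub_P]

@[simp] lemma assocInv_e (x : A.e) (y : B.e) (z : C.e) :
    (assocInv A B C).e (tmk x (tmk y z)) = tmk (tmk x y) z := by
  have h : (assocInv A B C).e (tmk x (tmk y z)) = tmk (tmk x y) z +
      (tensor (tensor A B) C).P 0 := by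
    simp only [assocInv, comp_e, comp_ee, braid_e_add, tmap_e, Hom.map_add_P, id_e, tmk_add_P_left,
      assocHom_e, H_tmk, add_P_add_P]
    -- The four braidings leave corrections that do not cancel in the ee-level; their sum is `T c -
    -- c` for this three-term `c`.
    refine congrArg _ (P_eq_of_eq_add (tt (tt (A.H x) (B.T (B.H y))) (C.Δ z) +
      tt (tt (A.H x) (B.cr y y)) (C.T (C.H z)) + tt (tt (A.Δ x) (B.H y)) (C.T (C.H z))) ?_)
    simp only [map_neg, map_add, AddMonoidHom.add_apply, AddMonoidHom.neg_apply, braid_ee, tmap_ee,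
      assocHom_ee, assocEE_tt, id_ee, T_add, T_tt, T_T, T_cr, T_Δ]
    abel
  simpa using h

lemma assocHom_assocInv (A B C : SquareGroup.{u}) : assocHom A B C ≫ assocInv A B C = 𝟙 _ :=
  tensor_hom_ext_left (by simp) (eeHom_ext_left (by simp))

lemma assocInv_assocHom (A B C : SquareGroup.{u}) : assocInv A B C ≫ assocHom A B C = 𝟙 _ :=
  tensor_hom_ext_right (by simp) (eeHom_ext_right (by simp))

/-- The associativity isomorphism. -/
noncomputable def assocIso (A B C : SquareGroup.{u}) :
    tensor (tensor A B) C ≅ tensor A (tensor B C) :=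
  ⟨assocHom A B C, assocInv A B C, assocHom_assocInv A B C, assocInv_assocHom A B C⟩

lemma tmk_zsmul_left (n : ℤ) (x : A.e) (y : B.e) : tmk (n • x) y =
    n • tmk x y + (tensor A B).P (tt (A.cr x x) ((n * (n - 1) / 2) • B.H y)) := by
  refine eq_of_step (g := fun n : ℤ => tmk (n • x) y)
    (h := fun n : ℤ => n • tmk x y +
      (tensor A B).P (tt (A.cr x x) ((n * (n - 1) / 2) • B.H y)))
    (s := fun n => tmk x y + (tensor A B).P (tt (A.cr x x) (n • B.H y))) ?_
    (fun n => ?_) (fun n => ?_) n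
  · have h := P_tmk (M := A) 0 y
    simpa using h
  · rw [add_one_zsmul, tmk_add_left, cr_zsmul_right, map_zsmul, map_zsmul, AddMonoidHom.coe_smul,
      Pi.smul_apply, add_assoc]
  · rw [add_one_zsmul, triangular_succ, add_smul, add_P_add_add_P, map_add]

/-! ### Coherence -/

lemma pentagon (A B C D : SquareGroup.{u}) :
    tmap (assocHom A B C) (𝟙 D) ≫ assocHom A (tensor B C) D ≫ tmap (𝟙 A) (assocHom B C D) =
      assocHom (tensor A B) C D ≫ assocHom A B (tensor C D) :=
  tensor_hom_ext_left_left (by simp) (eeHom_ext_left_left (by simp))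

/-- The correction in the left unit, pushed through `x ⊛ P(b) = (x|x) ⊗̄ b`, is the defect of `(n •
x) ⊛ y` computed in `tmk_zsmul_left`. -/
lemma triangle (A B : SquareGroup.{u}) :
    assocHom A Znil B ≫ tmap (𝟙 A) (leftUnitIso B).hom = tmap (rightUnitIso A).hom (𝟙 B) := by
  refine tensor_hom_ext_left (fun x n y => ?_) (eeHom_ext_left fun a n b => ?_)
  · simp only [rightUnitIso, comp_e, assocHom_e, tmap_e, id_e, leftUnitIso_e, rightUnit_e,
      tmk_add_P_right, tmk_zsmul_right, tmk_zsmul_left]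
  · simp [leftUnitIso_ee, rightUnitIso]

/-- The two summands of `H(y ⊛ z)` in the single braiding on the left are the corrections of the two
braidings on the right, already equal before applying `P`. -/
lemma hexagon (A B C : SquareGroup.{u}) :
    assocHom A B C ≫ braid A (tensor B C) ≫ assocHom B C A =
      tmap (braid A B) (𝟙 C) ≫ assocHom B A C ≫ tmap (𝟙 B) (braid A C) := by
  refine tensor_hom_ext_left (fun x y z => ?_) (eeHom_ext_left fun a b c => ?_)
  · simp only [comp_e, comp_ee, assocHom_e, braid_e_add, tmap_e, id_e, Hom.map_add_P,
      tmk_add_P_left, tmk_add_P_right, H_tmk, add_P_add_P]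
    refine congrArg (fun t => tmk y (tmk z x) + (tensor B (tensor C A)).P t) ?_
    simp [add_comm]
  · simp

lemma hexagon_inv (A B C : SquareGroup.{u}) :
    assocInv A B C ≫ braid (tensor A B) C ≫ assocInv C A B =
      tmap (𝟙 A) (braid B C) ≫ assocInv A C B ≫ tmap (braid A C) (𝟙 B) := by
  refine tensor_hom_ext_right (fun x y z => ?_) (eeHom_ext_right (by simp))
  simp only [comp_e, comp_ee, assocInv_e, braid_e_add, tmap_e, id_e, Hom.map_add_P,
    tmk_add_P_left, tmk_add_P_right, H_tmk, add_P_add_P]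
  refine congrArg (fun t => tmk (tmk z x) y + (tensor (tensor C A) B).P t) ?_
  simp [T_tt, T_cr, add_comm]

end SquareGroup

namespace SquareGroup

variable {A B C D : SquareGroup.{u}}

/-! ### The symmetric monoidal structure -/

lemma assoc_naturality {A' B' C' : SquareGroup.{u}} (f : A ⟶ A') (g : B ⟶ B') (h : C ⟶ C') :
    tmap (tmap f g) h ≫ assocHom A' B' C' = assocHom A B C ≫ tmap f (tmap g h) :=
  tensor_hom_ext_left (by simp) (eeHom_ext_left (by simp))

lemma rightUnit_naturality (f : A ⟶ B) :
    tmap f (𝟙 Znil) ≫ (rightUnitIso B).hom = (rightUnitIso A).hom ≫ f :=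
  tensor_hom_ext (by simp [rightUnitIso]) (eeHom_ext (by simp [rightUnitIso]))

lemma leftUnit_naturality (f : A ⟶ B) :
    tmap (𝟙 Znil) f ≫ (leftUnitIso B).hom = (leftUnitIso A).hom ≫ f :=
  tensor_hom_ext (by simp [leftUnitIso_e, Hom.map_H, Hom.map_P])
    (eeHom_ext (by simp [leftUnitIso_ee]))

/-- The data of the symmetric monoidal structure on square groups. -/
noncomputable def monoidalData : SymmetricMonoidalData SquareGroup.{u} where
  tensorObj := tensor
  tensorHom f g := tmap f g
  whiskerLeft M _ _ g := tmap (𝟙 M) g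
  whiskerRight f N := tmap f (𝟙 N)
  tensorUnit := Znil
  associator := assocIso
  leftUnitor := leftUnitIso
  rightUnitor := rightUnitIso
  braiding := braidIso

lemma monoidalData_isSymmetricMonoidal : monoidalData.{u}.IsSymmetricMonoidal := by
  let M : MonoidalCategory SquareGroup.{u} :=
    { monoidalData.{u}.toMonoidalCategoryStruct with
      tensorHom_def := fun f g => by
        change tmap f g = tmap f (𝟙 _) ≫ tmap (𝟙 _) g
        rw [← tmap_comp, Category.id_comp, Category.comp_id]
      id_tensorHom_id := tmap_id
      tensorHom_comp_tensorHom := fun f₁ f₂ g₁ g₂ => (tmap_comp f₁ g₁ f₂ g₂).symm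
      whiskerLeft_id := tmap_id
      id_whiskerRight := tmap_id
      associator_naturality := assoc_naturality
      leftUnitor_naturality := leftUnit_naturality
      rightUnitor_naturality := rightUnit_naturality
      pentagon := pentagon
      triangle := triangle }
  exact ⟨M,
    { braiding := braidIso
      braiding_naturality_right := fun X _ _ f => braid_naturality (𝟙 X) f
      braiding_naturality_left := fun f Z => braid_naturality f (𝟙 Z)
      hexagon_forward := hexagon
      hexagon_reverse := hexagon_inv
      symmetry := braid_braid }, rfl⟩

/-! ### Abelian groups -/

instance : abFunctor.{u}.Full where
  map_surjective f := ⟨AddCommGrpCat.ofHom f.e, Hom.ext rfl rfl⟩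

instance : abFunctor.{u}.Faithful where
  map_injective h := AddCommGrpCat.hom_ext (congrArg Hom.e h)

lemma abFunctor_essImage (M : SquareGroup.{u}) : abFunctor.essImage M ↔ Subsingleton M.ee := by
  constructor
  · rintro ⟨A, ⟨i⟩⟩
    refine ⟨fun a b => ?_⟩
    have h (c : M.ee) : i.hom.ee (i.inv.ee c) = c := by
      rw [← comp_ee, i.inv_hom_id, id_ee]
    rw [← h a, ← h b]
    rfl
  · intro h
    have hP (a : M.ee) : M.P a = 0 := by rw [Subsingleton.elim a 0, map_zero]
    -- Commutators are values of `P`, which is zero here.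
    let : AddCommGroup M.e := { M.addGroup with
      add_comm := fun x y => by rw [add_comm_P, hP, add_zero] }
    exact ⟨AddCommGrpCat.of M.e, ⟨
      { hom := ⟨AddMonoidHom.id _, 0, fun _ => Subsingleton.elim _ _, fun a => (hP _).symm⟩
        inv := ⟨AddMonoidHom.id _, 0, fun _ => rfl, fun a => hP a⟩
        hom_inv_id := Hom.ext rfl rfl
        inv_hom_id := Hom.ext rfl (AddMonoidHom.ext fun _ => Subsingleton.elim _ _) }⟩⟩

section

variable (A B : Type u) [AddCommGroup A] [AddCommGroup B]

lemma ofAb_ee (a : (tensor (ofAb A) (ofAb B)).ee) : a = 0 := by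
  induction a using ee_induction with
  | hzero => rfl
  | htt a b => rw [show a = 0 from rfl, map_zero]
  | hadd s t hs ht => rw [hs, ht, add_zero]

lemma exists_ofAbHom : ∃ φ : tensor (ofAb A) (ofAb B) ⟶ ofAb (A ⊗[ℤ] B),
    (∀ (x : A) (y : B), φ.e (tmk (M := ofAb A) (N := ofAb B) x y) = (x ⊗ₜ y : A ⊗[ℤ] B)) ∧
      φ.ee = 0 :=
  exists_hom (M := ofAb A) (N := ofAb B) (X := ofAb (A ⊗[ℤ] B))
    (fun x y => (x ⊗ₜ y : A ⊗[ℤ] B)) 0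
    (fun x y y' => TensorProduct.tmul_add x y y')
    (fun x x' y => (TensorProduct.add_tmul x x' y).trans (add_zero _).symm)
    (fun x _ => TensorProduct.tmul_zero B x) (fun _ y => TensorProduct.zero_tmul A y)
    (fun _ _ => rfl) (fun _ _ _ _ => rfl) (fun _ _ => rfl)

/-- The inverse of the comparison map to the usual tensor product. -/
noncomputable def ofAbInv : A ⊗[ℤ] B →+ (tensor (ofAb A) (ofAb B)).e :=
  -- The ee-level is trivial, so commutators vanish and the usual universal property is available.
  letI : AddCommGroup (tensor (ofAb A) (ofAb B)).e :=
    { (tensor (ofAb A) (ofAb B)).addGroup with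
      add_comm := fun x y => by
        rw [add_comm_P, ofAb_ee A B (cr _ _ _), map_zero, add_zero] }
  TensorProduct.liftAddHom
    (AddMonoidHom.mk' (fun x : A => AddMonoidHom.mk' (fun y : B =>
        tmk (M := ofAb A) (N := ofAb B) x y) fun y y' =>
          tmk_add_right (M := ofAb A) (N := ofAb B) x y y')
      fun x x' => AddMonoidHom.ext fun y =>
        (tmk_add_left (M := ofAb A) (N := ofAb B) x x' y).trans <| by
        rw [ofAb_ee A B (tt _ _), map_zero, add_zero]; rfl)
    fun r a b => by rw [map_zsmul, map_zsmul]; rfl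

/-- On abelian groups the tensor product of square groups is the usual tensor product. -/
noncomputable def ofAbIso : tensor (ofAb A) (ofAb B) ≅ ofAb (A ⊗[ℤ] B) where
  hom := (exists_ofAbHom A B).choose
  inv := ⟨ofAbInv A B, 0, fun _ => (ofAb_ee A B _).symm, fun _ => map_zero (ofAbInv A B)⟩
  hom_inv_id := tensor_hom_ext
    (fun x y => by
      rw [comp_e, (exists_ofAbHom A B).choose_spec.1]; rfl)
    (AddMonoidHom.ext fun _ => (ofAb_ee A B _).trans (ofAb_ee A B _).symm)
  inv_hom_id := by
    refine Hom.ext (AddMonoidHom.ext fun t => ?_) rfl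
    change (exists_ofAbHom A B).choose.e (ofAbInv A B t) = t
    induction t using TensorProduct.induction_on with
    | zero => rw [map_zero, map_zero]
    | tmul x y => exact (exists_ofAbHom A B).choose_spec.1 x y
    | add s t hs ht => rw [map_add, map_add, hs, ht]

lemma ofAbIso_tmk (x : A) (y : B) : (ofAbIso A B).hom.e (tmk (M := ofAb A) (N := ofAb B) x y) =
    (x ⊗ₜ y : A ⊗[ℤ] B) := (exists_ofAbHom A B).choose_spec.1 x y

lemma ofAb_braid (x : A) (y : B) : (braid (ofAb A) (ofAb B)).e (tmk (M := ofAb A) x y) =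
    tmk (M := ofAb B) (N := ofAb A) y x := by
  refine (braid_e (M := ofAb A) (N := ofAb B) x y).trans ?_
  rw [ofAb_ee B A (tt _ _), map_zero, sub_zero]

lemma hom_ofAb_ee {M : SquareGroup.{u}} (f g : M ⟶ ofAb A) : f.ee = g.ee :=
  AddMonoidHom.ext fun _ => rfl

end

end SquareGroup

/-! ### Assembly of the main theorem. -/

theorem mainTheorem1 :
    -- for all `M`, `N` the groups `(M ⊛ N)_e` and `M_ee ⊗ N_ee` form a square group `M ⊛ N`
    ∃ S : ∀ M N : SquareGroup.{u}, SquareStr (SquareGroup.TensorE M N) (M.ee ⊗[ℤ] N.ee),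
      -- with the prescribed `P` and with `H` the unique map satisfying the prescribed conditions
      (∀ M N : SquareGroup.{u},
        (∀ (a : M.ee) (b : N.ee), (S M N).P (a ⊗ₜ[ℤ] b) = SquareGroup.bar M N a b) ∧
        SquareGroup.IsTensorH M N (S M N).H ∧
        ∀ h : SquareGroup.TensorE M N → M.ee ⊗[ℤ] N.ee,
          SquareGroup.IsTensorH M N h → h = (S M N).H) ∧
      -- `Coker(P)` of `M ⊛ N` is the tensor product of the cokernels, and
      -- the cross-effect of `H` is the homomorphism `ρ`
      (∀ M N : SquareGroup.{u},
        ∃ (θ : (SquareGroup.of (S M N)).Coker ≃+ M.Coker ⊗[ℤ] N.Coker)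
          (ρ : (M.Coker ⊗[ℤ] N.Coker) ⊗[ℤ] (M.Coker ⊗[ℤ] N.Coker) →+ M.ee ⊗[ℤ] N.ee),
          (∀ (x : M.e) (y : N.e),
            θ ((SquareGroup.of (S M N)).cls (SquareGroup.op M N x y)) =
              M.cls x ⊗ₜ[ℤ] N.cls y) ∧
          (∀ (x x' : M.e) (y y' : N.e),
            ρ ((M.cls x ⊗ₜ[ℤ] N.cls y) ⊗ₜ[ℤ] (M.cls x' ⊗ₜ[ℤ] N.cls y')) =
              M.cr x x' ⊗ₜ[ℤ] N.cr y y') ∧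
          ∀ w w' : SquareGroup.TensorE M N,
            crossEffect (S M N).H w w' =
              ρ (θ ((SquareGroup.of (S M N)).cls w) ⊗ₜ[ℤ]
                θ ((SquareGroup.of (S M N)).cls w'))) ∧
      -- action on morphisms, associativity, unit and commutativity isomorphisms
      ∃ (map : ∀ {M M' N N' : SquareGroup.{u}}, (M ⟶ M') → (N ⟶ N') →
            (SquareGroup.of (S M N) ⟶ SquareGroup.of (S M' N')))
        (α : ∀ A B C : SquareGroup.{u},
            SquareGroup.of (S (SquareGroup.of (S A B)) C) ≅
              SquareGroup.of (S A (SquareGroup.of (S B C))))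
        (l : ∀ A : SquareGroup.{u}, SquareGroup.of (S SquareGroup.Znil A) ≅ A)
        (r : ∀ A : SquareGroup.{u}, SquareGroup.of (S A SquareGroup.Znil) ≅ A)
        (τ : ∀ A B : SquareGroup.{u}, SquareGroup.of (S A B) ≅ SquareGroup.of (S B A)),
        -- the action on morphisms
        (∀ (M M' N N' : SquareGroup.{u}) (f : M ⟶ M') (g : N ⟶ N'),
          (∀ (x : M.e) (y : N.e),
            (map f g).e (SquareGroup.op M N x y) = SquareGroup.op M' N' (f.e x) (g.e y)) ∧
          (∀ (a : M.ee) (b : N.ee),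
            (map f g).e (SquareGroup.bar M N a b) = SquareGroup.bar M' N' (f.ee a) (g.ee b)) ∧
          (∀ (a : M.ee) (b : N.ee),
            (map f g).ee (a ⊗ₜ[ℤ] b) = f.ee a ⊗ₜ[ℤ] g.ee b)) ∧
        -- the associativity isomorphism
        (∀ A B C : SquareGroup.{u},
          (∀ (a : A.ee) (b : B.ee) (c : C.ee),
            (α A B C).hom.ee ((a ⊗ₜ[ℤ] b) ⊗ₜ[ℤ] c) = a ⊗ₜ[ℤ] (b ⊗ₜ[ℤ] c)) ∧
          (∀ (x : A.e) (y : B.e) (z : C.e),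
            (α A B C).hom.e
                (SquareGroup.op (SquareGroup.of (S A B)) C (SquareGroup.op A B x y) z) =
              SquareGroup.op A (SquareGroup.of (S B C)) x (SquareGroup.op B C y z)) ∧
          (∀ (a : A.ee) (b : B.ee) (z : C.e),
            (α A B C).hom.e
                (SquareGroup.op (SquareGroup.of (S A B)) C (SquareGroup.bar A B a b) z) =
              SquareGroup.bar A (SquareGroup.of (S B C)) a (b ⊗ₜ[ℤ] C.Δ z)) ∧
          (∀ (a : A.ee) (b : B.ee) (c : C.ee),
            (α A B C).hom.e (SquareGroup.bar (SquareGroup.of (S A B)) C (a ⊗ₜ[ℤ] b) c) =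
              SquareGroup.bar A (SquareGroup.of (S B C)) a (b ⊗ₜ[ℤ] c)) ∧
          (∀ (x : A.e) (b : B.ee) (c : C.ee),
            SquareGroup.op A (SquareGroup.of (S B C)) x (SquareGroup.bar B C b c) =
                SquareGroup.bar A (SquareGroup.of (S B C)) (A.cr x x) (b ⊗ₜ[ℤ] c) ∧
            (α A B C).inv.e
                (SquareGroup.op A (SquareGroup.of (S B C)) x (SquareGroup.bar B C b c)) =
              SquareGroup.bar (SquareGroup.of (S A B)) C (A.cr x x ⊗ₜ[ℤ] b) c)) ∧
        -- the commutativity isomorphism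
        (∀ A B : SquareGroup.{u},
          (∀ (a : A.ee) (b : B.ee), (τ A B).hom.ee (a ⊗ₜ[ℤ] b) = b ⊗ₜ[ℤ] a) ∧
          (∀ (x : A.e) (y : B.e),
            (τ A B).hom.e (SquareGroup.op A B x y) =
              SquareGroup.op B A y x - SquareGroup.bar B A (B.H y) (A.T (A.H x))) ∧
          (∀ (a : A.ee) (b : B.ee),
            (τ A B).hom.e (SquareGroup.bar A B a b) = SquareGroup.bar B A b a)) ∧
        -- these data make square groups a symmetric monoidal category with unit `ℤ_nil`
        SymmetricMonoidalData.IsSymmetricMonoidal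
          { tensorObj := fun M N => SquareGroup.of (S M N)
            tensorHom := fun f g => map f g
            whiskerLeft := fun M _ _ g => map (𝟙 M) g
            whiskerRight := fun f N => map f (𝟙 N)
            tensorUnit := SquareGroup.Znil
            associator := α
            leftUnitor := l
            rightUnitor := r
            braiding := τ } ∧
        -- abelian groups are the square groups with trivial ee-level
        SquareGroup.abFunctor.{u}.Full ∧ SquareGroup.abFunctor.{u}.Faithful ∧
        (∀ M : SquareGroup.{u}, SquareGroup.abFunctor.essImage M ↔ Subsingleton M.ee) ∧
        -- on them `⊛` is the usual tensor product, naturally and compatibly with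
        -- the associativity and commutativity isomorphisms
        ∃ μ : ∀ A B : AddCommGrpCat.{u},
            SquareGroup.of (S (SquareGroup.abFunctor.obj A) (SquareGroup.abFunctor.obj B)) ≅
              SquareGroup.abFunctor.obj (AddCommGrpCat.of (A ⊗[ℤ] B)),
          (∀ (A B : AddCommGrpCat.{u}) (x : A) (y : B),
            (μ A B).hom.e
                (SquareGroup.op (SquareGroup.abFunctor.obj A) (SquareGroup.abFunctor.obj B) x y) =
              (x ⊗ₜ[ℤ] y : A ⊗[ℤ] B)) ∧
          (∀ (A A' B B' : AddCommGrpCat.{u}) (f : A ⟶ A') (g : B ⟶ B'),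
            map (SquareGroup.abFunctor.map f) (SquareGroup.abFunctor.map g) ≫ (μ A' B').hom =
              (μ A B).hom ≫ SquareGroup.abFunctor.map (AddCommGrpCat.ofHom
                (TensorProduct.map f.hom.toIntLinearMap g.hom.toIntLinearMap).toAddMonoidHom)) ∧
          (∀ A B C : AddCommGrpCat.{u},
            (α (SquareGroup.abFunctor.obj A) (SquareGroup.abFunctor.obj B)
                (SquareGroup.abFunctor.obj C)).hom ≫
              map (𝟙 (SquareGroup.abFunctor.obj A)) (μ B C).hom ≫
                (μ A (AddCommGrpCat.of (B ⊗[ℤ] C))).hom =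
            map (μ A B).hom (𝟙 (SquareGroup.abFunctor.obj C)) ≫
              (μ (AddCommGrpCat.of (A ⊗[ℤ] B)) C).hom ≫
                SquareGroup.abFunctor.map (AddCommGrpCat.ofHom
                  (TensorProduct.assoc ℤ A B C).toLinearMap.toAddMonoidHom)) ∧
          (∀ A B : AddCommGrpCat.{u},
            (τ (SquareGroup.abFunctor.obj A) (SquareGroup.abFunctor.obj B)).hom ≫ (μ B A).hom =
              (μ A B).hom ≫ SquareGroup.abFunctor.map (AddCommGrpCat.ofHom
                (TensorProduct.comm ℤ A B).toLinearMap.toAddMonoidHom)) := by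
  open SquareGroup in
  refine ⟨tensorStr, fun M N => ⟨tensorStr_P, isTensorH_tensorStr M N,
      fun h hh => hh.unique (isTensorH_tensorStr M N)⟩,
    fun M N => ⟨cokerTensorEquiv M N, rhoTensor M N, TensorE.toCoker_op, rho_tmul,
      crossEffect_tensorStr⟩,
    tmap, assocIso, leftUnitIso, rightUnitIso, braidIso,
    fun M M' N N' f g => ⟨tmap_e f g, fun a b => ?_, tmap_ee f g⟩,
    fun A B C => ⟨fun a b c => ?_, assocHom_e, fun a b z => ?_, fun a b c => ?_, fun x b c => ⟨?_, ?_⟩⟩,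
    fun A B => ⟨braid_ee, braid_e, fun a b => ?_⟩, monoidalData_isSymmetricMonoidal,
    inferInstance, inferInstance, abFunctor_essImage, fun A B => ofAbIso A B,
    fun A B => ofAbIso_tmk A B, fun A A' B B' f g => ?_, fun A B C => ?_, fun A B => ?_⟩
  · exact ((tmap f g).map_P (tt a b)).trans (congrArg _ (tmap_ee f g a b))
  · exact (assocHom_ee (tt (tt a b) c)).trans (assocEE_tt a b c)
  · change (assocHom A B C).e (tmk ((tensor A B).P (tt a b)) z) =
      (tensor A (tensor B C)).P (tt a (tt b (C.Δ z)))
    rw [P_tmk, Hom.map_P, assocHom_ee, assocEE_tt]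
  · change (assocHom A B C).e ((tensor (tensor A B) C).P (tt (tt a b) c)) =
      (tensor A (tensor B C)).P (tt a (tt b c))
    rw [Hom.map_P, assocHom_ee, assocEE_tt]
  · exact tmk_P x (tt b c)
  · change (assocInv A B C).e (tmk x ((tensor B C).P (tt b c))) =
      (tensor (tensor A B) C).P (tt (tt (A.cr x x) b) c)
    rw [tmk_P, Hom.map_P, assocInv_ee]
  · exact ((braid A B).map_P (tt a b)).trans (congrArg _ (braid_ee a b))
  -- The target has trivial ee-level, so this and the two remaining squares need checking only on
  -- generators of the e-level.
  · refine tensor_hom_ext (fun x y => ?_) (hom_ofAb_ee _ _ _)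
    exact (congrArg (ofAbIso A' B').hom.e (tmap_e (abFunctor.map f) (abFunctor.map g) x y)).trans
      ((ofAbIso_tmk A' B' (f.hom x) (g.hom y)).trans (congrArg
        (TensorProduct.map f.hom.toIntLinearMap g.hom.toIntLinearMap) (ofAbIso_tmk A B x y)).symm)
  · refine tensor_hom_ext_left (fun x y z => ?_) (hom_ofAb_ee _ _ _)
    have h₁ : (tmap (𝟙 (ofAb A)) (ofAbIso B C).hom).e (tmk (M := ofAb A) x
        (tmk (M := ofAb B) (N := ofAb C) y z)) =
        tmk (M := ofAb A) (N := ofAb (B ⊗[ℤ] C)) x (y ⊗ₜ[ℤ] z : B ⊗[ℤ] C) :=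
      (tmap_e _ _ _ _).trans (congrArg _ (ofAbIso_tmk B C y z))
    have h₂ : (tmap (ofAbIso A B).hom (𝟙 (ofAb C))).e (tmk (N := ofAb C)
        (tmk (M := ofAb A) (N := ofAb B) x y) z) =
        tmk (M := ofAb (A ⊗[ℤ] B)) (N := ofAb C) (x ⊗ₜ[ℤ] y : A ⊗[ℤ] B) z :=
      (tmap_e _ _ _ _).trans (congrArg (fun t => tmk (M := ofAb (A ⊗[ℤ] B)) (N := ofAb C) t z)
        (ofAbIso_tmk A B x y))
    exact (congrArg (fun w => (ofAbIso A (B ⊗[ℤ] C)).hom.e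
        ((tmap (𝟙 (ofAb A)) (ofAbIso B C).hom).e w)) (assocHom_e x y z)).trans
      ((congrArg (ofAbIso A (B ⊗[ℤ] C)).hom.e h₁).trans
        ((ofAbIso_tmk A (B ⊗[ℤ] C) x (y ⊗ₜ[ℤ] z)).trans
          (congrArg (TensorProduct.assoc ℤ A B C)
            ((congrArg (ofAbIso (A ⊗[ℤ] B) C).hom.e h₂).trans
              (ofAbIso_tmk (A ⊗[ℤ] B) C (x ⊗ₜ[ℤ] y) z))).symm))
  · refine tensor_hom_ext (fun x y => ?_) (hom_ofAb_ee _ _ _)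
    exact (congrArg (ofAbIso B A).hom.e (ofAb_braid A B x y)).trans ((ofAbIso_tmk B A y x).trans
      (congrArg (TensorProduct.comm ℤ A B) (ofAbIso_tmk A B x y)).symm)
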